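/- Let $\Omega^+\subset\mathbb{C}=\mathbb{R}^2$ be a polygonal billiard table: the compact region bounded by a simple closed polygon $B^+$. Let $A^+\subseteq B^+$ be a nondegenerate vertical segment containing no corner of $B^+$, let $\rho$ be the reflection in a vertical line that does not meet the interior of $\Omega^+$, and put $\Omega^-=\rho(\Omega^+)$, $B^-=\rho(B^+)$, $A^-=\rho(A^+)$. The phase space of the polygonal Andreev billiard is $((\Omega^+\sqcup\Omega^-)\times S^1)/\sim_\pm$, where $\sim_\pm$ is the equivalence relation given, besides equality, by - $(x,\theta)\sim_\pm(x,r(\theta))$ for $x$ a point of $B^+$ (or of $B^-$) that is neither a corner nor in $A^+$ (resp. $A^-$), where $r$ is the reflection of directions through the tangent line at $x$; - $(x,\theta)\sim_\pm(\rho(x),r(\theta)+\pi)$ for $x$ in $A^+$ (or in $A^-$), $\rho(x)$ being taken in the other copy and $r$ being the reflection through the vertical. The Andreev flow $\Phi_\pm^t$ moves a point in the interior of either table at unit speed along its direction; when it arrives at a boundary point that is not a corner, it continues along the inward-pointing representative of its $\sim_\pm$-class. An orbit is defined for all times $t\in\mathbb{R}$ only if it never meets a corner. For a direction $\theta$, let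 $M^\pm_\theta$ be the set of classes of all $(x,\theta')$ with $x\in\Omega^+\sqcup\Omega^-$ and $\theta'$ obtained from $\theta$ by finitely many reflections in the sides of the two tables and changes of direction $\theta\mapsto r(\theta)+\pi$ at the Andreev segments; this set is invariant under the flow. Suppose that the polygon is rational, i.e. every interior angle of $B^+$ is a rational multiple of $\pi$. Then for Lebesgue-almost every direction $\theta$ the flow restricted to $M^\pm_\theta$ is closed: for every orbit $t\mapsto\Phi_\pm^t(p)$, $p\in M^\pm_\theta$, that is defined for all $t\in\mathbb{R}$, there is $T>0$ such that $\Phi_\pm^{t+T}(p)=\Phi_\pm^{t}(p)$ for all $t\in\mathbb{R}$. -/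

import Mathlib

open Set MeasureTheory

noncomputable section

/-- A polygonal billiard table in the plane `ℂ`: a compact region whose boundary is the simple
closed polygon with cyclically indexed vertices `vertex i`. -/
structure PolygonalBilliard where
  n : ℕ
  three_le : 3 ≤ n
  vertex : ZMod n → ℂ
  vertex_injective : Function.Injective vertex
  /-- consecutive sides meet only in their common vertex -/
  side_inter_next : ∀ i, segment ℝ (vertex i) (vertex (i + 1)) ∩
    segment ℝ (vertex (i + 1)) (vertex (i + 1 + 1)) = {vertex (i + 1)}
  /-- sides that are not consecutive are disjoint -/
  side_disjoint : ∀ i j, j ≠ i → j ≠ i + 1 → i ≠ j + 1 →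
    Disjoint (segment ℝ (vertex i) (vertex (i + 1))) (segment ℝ (vertex j) (vertex (j + 1)))
  /-- the closed region bounded by the polygon -/
  table : Set ℂ
  isCompact_table : IsCompact table
  closure_interior_table : closure (interior table) = table
  isConnected_interior_table : IsConnected (interior table)
  frontier_table : frontier table = ⋃ i, segment ℝ (vertex i) (vertex (i + 1))

namespace PolygonalBilliard

variable (P : PolygonalBilliard)

/-- The side from `vertex i` to `vertex (i + 1)` without its end points. -/
def openSide (i : ZMod P.n) : Set ℂ := openSegment ℝ (P.vertex i) (P.vertex (i + 1))

/-- The sum of the two unit vectors that point from `vertex i` along the sides that meet there. -/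
def bisector (i : ZMod P.n) : ℂ :=
  (‖P.vertex (i + 1) - P.vertex i‖⁻¹ : ℝ) • (P.vertex (i + 1) - P.vertex i) +
    (‖P.vertex (i - 1) - P.vertex i‖⁻¹ : ℝ) • (P.vertex (i - 1) - P.vertex i)

open Classical in
/-- The interior angle at `vertex i`, in `(0, 2π)`: the angle between the two sides if the table
lies locally between them (the bisector points into the table), and `2π` minus it otherwise. -/
def interiorAngle (i : ZMod P.n) : ℝ :=
  if ∃ ε > 0, ∀ t ∈ Ioo (0 : ℝ) ε, P.vertex i + t • P.bisector i ∈ interior P.table then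
    EuclideanGeometry.angle (P.vertex (i - 1)) (P.vertex i) (P.vertex (i + 1))
  else
    2 * Real.pi - EuclideanGeometry.angle (P.vertex (i - 1)) (P.vertex i) (P.vertex (i + 1))

/-- A rational polygon: every interior angle is a rational multiple of `π`. -/
def IsRational : Prop := ∀ i, ∃ q : ℚ, P.interiorAngle i = q * Real.pi

theorem vertex_ne_succ (i : ZMod P.n) : P.vertex i ≠ P.vertex (i + 1) := by
  intro h
  have h1 := P.vertex_injective h
  have : Fact (1 < P.n) := ⟨by have := P.three_le; omega⟩
  exact one_ne_zero (α := ZMod P.n) (by simpa using h1.symm)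

theorem openSide_inter_next (i : ZMod P.n) {z : ℂ} (h : z ∈ P.openSide i)
    (h' : z ∈ P.openSide (i + 1)) : False := by
  have hz : z ∈ ({P.vertex (i + 1)} : Set ℂ) := by
    rw [← P.side_inter_next i]
    exact ⟨openSegment_subset_segment ℝ _ _ h, openSegment_subset_segment ℝ _ _ h'⟩
  rw [mem_singleton_iff] at hz
  subst hz
  exact P.vertex_ne_succ i (right_mem_openSegment_iff.mp h)

/-- A boundary point that is not a corner lies on one side only. -/
theorem openSide_unique {i j : ZMod P.n} {z : ℂ} (hi : z ∈ P.openSide i)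
    (hj : z ∈ P.openSide j) : i = j := by
  by_contra hij
  by_cases h1 : j = i + 1
  · subst h1
    exact P.openSide_inter_next i hi hj
  by_cases h2 : i = j + 1
  · subst h2
    exact P.openSide_inter_next j hj hi
  exact Set.disjoint_left.mp (P.side_disjoint i j (Ne.symm hij) h1 h2)
    (openSegment_subset_segment ℝ _ _ hi) (openSegment_subset_segment ℝ _ _ hj)

end PolygonalBilliard

/-- The two copies of the table, labelled by the parity of the point mass. -/
inductive Parity where
  | plus
  | minus

/-- The other parity. -/
def Parity.flip : Parity → Parity
  | .plus => .minus
  | .minus => .plus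

/-- Reflection of the direction `θ` through a line that makes the angle `α` with the horizontal. -/
def reflectDir (α θ : Real.Angle) : Real.Angle := (2 : ℕ) • α - θ

/-- The change of direction at the Andreev subset: reflection through the vertical tangent line
followed by a half turn, `θ ↦ r(θ) + π`. -/
def andreevDir (θ : Real.Angle) : Real.Angle :=
  reflectDir ((Real.pi / 2 : ℝ) : Real.Angle) θ + ((Real.pi : ℝ) : Real.Angle)

theorem reflectDir_reflectDir (α θ : Real.Angle) : reflectDir α (reflectDir α θ) = θ := by
  simp [reflectDir]

theorem andreevDir_eq_neg (θ : Real.Angle) : andreevDir θ = -θ := by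
  have h : (2 : ℕ) • ((Real.pi / 2 : ℝ) : Real.Angle) = ((Real.pi : ℝ) : Real.Angle) := by
    rw [← Real.Angle.coe_nsmul]
    congr 1
    simp
    ring
  have h2 := Real.Angle.coe_pi_add_coe_pi
  unfold andreevDir reflectDir
  rw [h, sub_add_eq_add_sub, h2, zero_sub]

/-- A polygonal Andreev billiard: a polygonal billiard `Ω⁺` together with a nondegenerate vertical
segment `A⁺` of its boundary that contains no corner, and a vertical line `Re z = axis` that does
not meet the interior of `Ω⁺`. The second table `Ω⁻` is the mirror image of `Ω⁺` in that line. -/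
structure PolygonalAndreevBilliard extends PolygonalBilliard where
  andreevSegment : Set ℂ
  andreevSegment_nontrivial : andreevSegment.Nontrivial
  andreevSegment_connected : IsConnected andreevSegment
  andreevSegment_subset : andreevSegment ⊆ frontier table \ range vertex
  andreevSegment_vertical : ∀ z ∈ andreevSegment, ∀ w ∈ andreevSegment, z.re = w.re
  axis : ℝ
  axis_disjoint : ∀ z ∈ interior table, z.re ≠ axis

namespace PolygonalAndreevBilliard

variable (P : PolygonalAndreevBilliard)

/-- The reflection `ρ` through the line `Re z = axis`. -/
def rho (z : ℂ) : ℂ := ⟨2 * P.axis - z.re, z.im⟩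

/-- The map that carries `Ω⁺` to the table of the given parity: the identity or `ρ`. -/
def place : Parity → ℂ → ℂ
  | .plus, z => z
  | .minus, z => P.rho z

/-- The tables `Ω⁺` and `Ω⁻ = ρ(Ω⁺)`. -/
def tableOf (ε : Parity) : Set ℂ := P.place ε '' P.table

/-- The interiors of `Ω⁺` and `Ω⁻`. -/
def insideOf (ε : Parity) : Set ℂ := interior (P.tableOf ε)

/-- The corners of `Ω⁺` and `Ω⁻`. -/
def vertexOf (ε : Parity) (i : ZMod P.n) : ℂ := P.place ε (P.vertex i)

/-- The open sides of `Ω⁺` and `Ω⁻`. -/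
def openSideOf (ε : Parity) (i : ZMod P.n) : Set ℂ := P.place ε '' P.openSide i

/-- The two parts `A⁺` and `A⁻ = ρ(A⁺)` of the Andreev subset. -/
def andreevOf (ε : Parity) : Set ℂ := P.place ε '' P.andreevSegment

/-- The angle between the `i`-th side of the table of parity `ε` and the horizontal. -/
def sideAngle (ε : Parity) (i : ZMod P.n) : Real.Angle :=
  ((Complex.arg (P.vertexOf ε (i + 1) - P.vertexOf ε i) : ℝ) : Real.Angle)

/-- A point of `(Ω⁺ ⊔ Ω⁻) × S¹`. -/
@[ext]
structure State where
  parity : Parity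
  pos : ℂ
  dir : Real.Angle
  pos_mem : pos ∈ P.tableOf parity

variable {P}

/-- The relation `∼±` on `(Ω⁺ ⊔ Ω⁻) × S¹`. Besides equality, it identifies a direction at a
boundary point off the Andreev subset and off the corners with its mirror image in the tangent
line, and `(x, θ)` with `(ρ(x), r(θ) + π)` for `x` in the Andreev subset. -/
inductive Rel : P.State → P.State → Prop
  | refl (p : P.State) : Rel p p
  | side (p q : P.State) (i : ZMod P.n) (hparity : q.parity = p.parity) (hpos : q.pos = p.pos)
      (hside : p.pos ∈ P.openSideOf p.parity i) (hA : p.pos ∉ P.andreevOf p.parity)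
      (hdir : q.dir = reflectDir (P.sideAngle p.parity i) p.dir) : Rel p q
  | andreev (p q : P.State) (hparity : q.parity = p.parity.flip) (hpos : q.pos = P.rho p.pos)
      (hA : p.pos ∈ P.andreevOf p.parity) (hdir : q.dir = andreevDir p.dir) : Rel p q

theorem rho_rho (z : ℂ) : P.rho (P.rho z) = z := by
  apply Complex.ext <;> simp [rho]

theorem place_injective (ε : Parity) : Function.Injective (P.place ε) := by
  intro z w h
  cases ε
  · exact h
  · have h' : P.rho z = P.rho w := h
    rw [← rho_rho (P := P) z, h', rho_rho]

theorem rho_mem_andreevOf {ε : Parity} {z : ℂ} (h : z ∈ P.andreevOf ε) :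
    P.rho z ∈ P.andreevOf ε.flip := by
  obtain ⟨w, hw, rfl⟩ := h
  cases ε
  · exact ⟨w, hw, rfl⟩
  · exact ⟨w, hw, (rho_rho w).symm⟩

theorem openSideOf_unique {ε : Parity} {i j : ZMod P.n} {z : ℂ} (hi : z ∈ P.openSideOf ε i)
    (hj : z ∈ P.openSideOf ε j) : i = j := by
  obtain ⟨a, ha, rfl⟩ := hi
  obtain ⟨b, hb, hab⟩ := hj
  rw [place_injective ε hab] at hb
  exact P.toPolygonalBilliard.openSide_unique ha hb

theorem Rel.symm {p q : P.State} (h : Rel p q) : Rel q p := by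
  cases h with
  | refl => exact Rel.refl _
  | side _ i hparity hpos hside hA hdir =>
    refine Rel.side _ _ i hparity.symm hpos.symm ?_ ?_ ?_
    · rw [hpos, hparity]; exact hside
    · rw [hpos, hparity]; exact hA
    · rw [hparity, hdir, reflectDir_reflectDir]
  | andreev _ hparity hpos hA hdir =>
    refine Rel.andreev _ _ ?_ ?_ ?_ ?_
    · rw [hparity]; cases p.parity <;> rfl
    · rw [hpos, rho_rho]
    · rw [hpos, hparity]; exact rho_mem_andreevOf hA
    · rw [hdir, andreevDir_eq_neg, andreevDir_eq_neg, neg_neg]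

theorem Rel.trans {p q s : P.State} (h : Rel p q) (h' : Rel q s) : Rel p s := by
  cases h with
  | refl => exact h'
  | side _ i hparity hpos hside hA hdir =>
    cases h' with
    | refl => exact Rel.side _ _ i hparity hpos hside hA hdir
    | side _ j hparity' hpos' hside' hA' hdir' =>
      rw [hpos, hparity] at hside'
      have hij := openSideOf_unique hside hside'
      subst hij
      have : p = s := by
        apply State.ext
        · rw [hparity', hparity]
        · rw [hpos', hpos]
        · rw [hdir', hparity, hdir, reflectDir_reflectDir]
      subst this
      exact Rel.refl _
    | andreev _ hparity' hpos' hA' hdir' =>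
      rw [hpos, hparity] at hA'
      exact absurd hA' hA
  | andreev _ hparity hpos hA hdir =>
    cases h' with
    | refl => exact Rel.andreev _ _ hparity hpos hA hdir
    | side _ j hparity' hpos' hside' hA' hdir' =>
      rw [hpos, hparity] at hA'
      exact absurd (rho_mem_andreevOf hA) hA'
    | andreev _ hparity' hpos' hA' hdir' =>
      have : p = s := by
        apply State.ext
        · rw [hparity', hparity]; cases p.parity <;> rfl
        · rw [hpos', hpos, rho_rho]
        · rw [hdir', hdir, andreevDir_eq_neg, andreevDir_eq_neg, neg_neg]
      subst this
      exact Rel.refl _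

variable (P)

/-- `∼±` as an equivalence relation. -/
def stateSetoid : Setoid P.State where
  r := Rel
  iseqv := ⟨Rel.refl, Rel.symm, Rel.trans⟩

/-- The phase space `((Ω⁺ ⊔ Ω⁻) × S¹) / ∼±`. -/
def PhaseSpace : Type := Quotient P.stateSetoid

variable {P}

/-- The class of a state in the phase space. -/
def toPhase (p : P.State) : P.PhaseSpace := Quotient.mk P.stateSetoid p

/-- The base point of the class `x` is a corner. -/
def AtCorner (x : P.PhaseSpace) : Prop :=
  ∃ p : P.State, toPhase p = x ∧ p.pos ∈ range (P.vertexOf p.parity)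

/-- `w` is reached from `p` by unit speed motion along a straight line for the (positive or
negative) time `s`, and `w` lies in the interior of the table. -/
def FreeMotion (p : P.State) (s : ℝ) (w : P.State) : Prop :=
  w.parity = p.parity ∧ w.dir = p.dir ∧ w.pos = p.pos + s * (p.dir.toCircle : ℂ) ∧
    w.pos ∈ P.insideOf w.parity

/-- `c` is an orbit `t ↦ Φ^t(c 0)` of the Andreev flow, defined for all times: it never meets a
corner, and around each time `t` it moves freely, arriving along the direction of one
representative `q` of `c t` and departing along the direction of one representative `p` of `c t`.
(In the interior `p = q`; at the boundary `q` points outward and `p` inward.) -/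
def IsFlowLine (c : ℝ → P.PhaseSpace) : Prop :=
  ∀ t : ℝ, ¬ AtCorner (c t) ∧ ∃ p q : P.State, toPhase p = c t ∧ toPhase q = c t ∧
    ∃ δ > 0, (∀ s ∈ Ioo (0 : ℝ) δ, ∃ w, toPhase w = c (t + s) ∧ FreeMotion p s w) ∧
      (∀ s ∈ Ioo (-δ) (0 : ℝ), ∃ w, toPhase w = c (t + s) ∧ FreeMotion q s w)

variable (P)

/-- The directions `θ, θ₁, θ₂, …` that arise from `θ` through reflections in the sides of the two
tables and through the change of direction at the Andreev subset. -/
inductive IsDirectionFrom (θ : Real.Angle) : Real.Angle → Prop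
  | base : IsDirectionFrom θ θ
  | side (ε : Parity) (i : ZMod P.n) (u : Real.Angle) (hu : IsDirectionFrom θ u) :
      IsDirectionFrom θ (reflectDir (P.sideAngle ε i) u)
  | andreev (u : Real.Angle) (hu : IsDirectionFrom θ u) : IsDirectionFrom θ (andreevDir u)

/-- The invariant surface `M±_θ` in the phase space. -/
def invariantSurface (θ : Real.Angle) : Set P.PhaseSpace :=
  toPhase '' {p : P.State | P.IsDirectionFrom θ p.dir}

variable {P}

/-- The flow restricted to `M` is closed: all its orbits in `M` are periodic. -/
def FlowIsClosedOn (M : Set P.PhaseSpace) : Prop :=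
  ∀ c : ℝ → P.PhaseSpace, IsFlowLine c → c 0 ∈ M → ∃ T > 0, Function.Periodic c T

end PolygonalAndreevBilliard

end

/-! Periodicity comes from a symmetry. The retroreflection `(x, θ) ↦ (ρ(x), r(θ) + π)` carries flow
lines to time-reversed flow lines and fixes every class over the Andreev subset. By uniqueness of
flow lines (`IsFlowLine.eq`), an orbit that meets the Andreev subset at time `a` satisfies `c t = R
(c (2a - t))`; two such times `a < b` give the period `2 (b - a)` (`IsFlowLine.periodic`). It
remains to see that almost every direction forces each orbit to meet the Andreev subset in the
future and, by time reversal, in the past.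

Fold both tables onto `Ω⁺`. An orbit that avoids the Andreev subset from some time on becomes an
infinite ordinary billiard orbit in a rational polygon. Its directions lie in a finite set:
reflections in the sides have linear parts with `N`-th roots of unity as coefficients (`linWord_eq`,
`exists_pow_turn_eq_one`). For almost every direction no two corner images under the reflection
group differ by a nonzero multiple of it (`ae_generic`). Unfolding then shows that no orbit joins
two corners and none is periodic, so the billiard map is a local isometry of finitely many intervals
without connections (`bounceMap`).

Such orbits are dense in the boundary (`exists_point_mem`). The accumulation set is closed,
invariant and nonempty (`clusterSet_nonempty`). A closed invariant set contains every interval that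
it meets (`IntervalMap.mem_of_invariant`, the argument of Keane for interval exchanges).
Connectedness of the interior then spreads it to all sides. So the orbit does hit the Andreev
segment, a contradiction (`IsFlowLine.exists_atAndreev`). -/

/-- At the infimum of the counterexamples `p` holds by `hlim`, and `hstep` then keeps
counterexamples away from its right. -/
theorem real_induction {p : ℝ → Prop} {τ : ℝ} (h0 : p 0)
    (hstep : ∀ s, 0 ≤ s → s < τ → (∀ r, 0 ≤ r → r ≤ s → p r) → ∃ δ > 0, ∀ r, s < r → r < s + δ → p r)
    (hlim : ∀ s, 0 < s → s ≤ τ → (∀ r, 0 ≤ r → r < s → p r) → p s) :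
    ∀ s, 0 ≤ s → s ≤ τ → p s := by
  by_contra! hcon
  obtain ⟨s, hs0, hsτ, hs⟩ := hcon
  set B : Set ℝ := {s | 0 ≤ s ∧ s ≤ τ ∧ ¬ p s}
  have hB : B.Nonempty := ⟨s, hs0, hsτ, hs⟩
  have hbd : BddBelow B := ⟨0, fun x hx => hx.1⟩
  have hm0 : 0 ≤ sInf B := le_csInf hB fun x hx => hx.1
  have hms : sInf B ≤ s := csInf_le hbd ⟨hs0, hsτ, hs⟩
  have hlt : ∀ r, 0 ≤ r → r < sInf B → p r := by
    intro r hr0 hr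
    by_contra hpr
    exact absurd (csInf_le hbd (⟨hr0, by linarith, hpr⟩ : r ∈ B)) (not_le.mpr hr)
  have hpm : p (sInf B) := by
    rcases hm0.eq_or_lt with h | h
    · rw [← h]; exact h0
    · exact hlim _ h (by linarith) hlt
  have hne : sInf B ≠ s := fun h => hs (h ▸ hpm)
  have hmτ : sInf B < τ := by
    have := lt_of_le_of_ne hms hne
    linarith
  obtain ⟨δ, hδ, hδp⟩ := hstep _ hm0 hmτ fun r hr0 hr => by
    rcases hr.eq_or_lt with h | h
    · rw [h]; exact hpm
    · exact hlt r hr0 h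
  obtain ⟨r, hrB, hr⟩ := exists_lt_of_csInf_lt hB (lt_add_of_pos_right (sInf B) hδ)
  rcases (csInf_le hbd hrB).eq_or_lt with h | h
  · exact hrB.2.2 (h ▸ hpm)
  · exact hrB.2.2 (hδp r h hr)

/-! ### Interval maps without connections -/

/-- A partially defined injective map of the finite disjoint union of the intervals `(0, width a)`
that is locally an isometry, is defined and has a preimage off finitely many points, has no
periodic points, and for which no orbit runs from a point without preimage to a point without
image. -/
structure IntervalMap (α : Type*) where
  width : α → ℝ
  Step : α × ℝ → α × ℝ → Prop
  sgn : α → α → ℝ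
  mem_left : ∀ {x y}, Step x y → x.2 ∈ Ioo 0 (width x.1)
  mem_right : ∀ {x y}, Step x y → y.2 ∈ Ioo 0 (width y.1)
  right_unique : ∀ {x y z}, Step x y → Step x z → y = z
  left_unique : ∀ {x y z}, Step x z → Step y z → x = y
  sgn_eq : ∀ a b, sgn a b = 1 ∨ sgn a b = -1
  isometry : ∀ {a b s t}, Step (a, s) (b, t) →
    ∀ᶠ h in nhds (0 : ℝ), Step (a, s + h) (b, t + sgn a b * h)
  finite_out : {x : α × ℝ | x.2 ∈ Ioo 0 (width x.1) ∧ ∀ y, ¬ Step x y}.Finite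
  finite_in : {x : α × ℝ | x.2 ∈ Ioo 0 (width x.1) ∧ ∀ y, ¬ Step y x}.Finite
  no_connection : ∀ {x y}, x.2 ∈ Ioo 0 (width x.1) → (∀ w, ¬ Step w x) →
    Relation.ReflTransGen Step x y → ∃ z, Step y z
  no_periodic : ∀ x, ¬ Relation.TransGen Step x x

namespace IntervalMap

variable {α : Type*} (S : IntervalMap α)

theorem sgn_mul_self (a b : α) : S.sgn a b * S.sgn a b = 1 := by
  rcases S.sgn_eq a b with h | h <;> rw [h] <;> norm_num

/-- The inverse map. -/
def inverse : IntervalMap α where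
  width := S.width
  Step x y := S.Step y x
  sgn a b := S.sgn b a
  mem_left := S.mem_right
  mem_right := S.mem_left
  right_unique := S.left_unique
  left_unique := S.right_unique
  sgn_eq a b := S.sgn_eq b a
  isometry := by
    intro a b s t h
    have h1 := S.isometry h
    have h2 : Filter.Tendsto (fun h : ℝ => S.sgn b a * h) (nhds 0) (nhds 0) := by
      have : Continuous (fun h : ℝ => S.sgn b a * h) := by fun_prop
      simpa using this.tendsto 0
    filter_upwards [h2.eventually h1] with r hr
    rwa [← mul_assoc, S.sgn_mul_self, one_mul] at hr
  finite_out := S.finite_in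
  finite_in := S.finite_out
  no_connection := by
    intro x y hx hx' hxy
    by_contra! hy
    have hxy' : Relation.ReflTransGen S.Step y x := Relation.reflTransGen_swap.mp hxy
    rcases hxy.cases_head with h | ⟨z, hz, hzy⟩
    · subst h
      exact (S.no_connection hx hy Relation.ReflTransGen.refl).elim hx'
    · rcases hxy.cases_tail with h | ⟨w, hw, hwy⟩
      · subst h
        exact hy _ hz |>.elim
      · exact (S.no_connection (S.mem_left hwy) hy hxy').elim hx'
  no_periodic x h := S.no_periodic x (Relation.transGen_swap.mp h)

/-- An interval free of points without image is carried rigidly into one interval: the formula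
persists to the right by `isometry`, and at a limit point the existing image must agree with the
earlier ones by `right_unique`. -/
theorem step_along {b b' : α × ℝ} (hb : S.Step b b') {σ s : ℝ}
    (hout : ∀ r ∈ Ioo 0 s, ∃ y, S.Step (b.1, b.2 + σ * r) y) :
    ∀ r, 0 ≤ r → r < s →
      S.Step (b.1, b.2 + σ * r) (b'.1, b'.2 + S.sgn b.1 b'.1 * σ * r) := by
  intro r hr hrs
  refine real_induction (τ := r) (p := fun r =>
    S.Step (b.1, b.2 + σ * r) (b'.1, b'.2 + S.sgn b.1 b'.1 * σ * r)) ?_ ?_ ?_ r hr le_rfl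
  · simpa using hb
  · intro t ht0 htr hp
    have h1 := S.isometry (hp t ht0 le_rfl)
    have h2 : Filter.Tendsto (fun u : ℝ => σ * (u - t)) (nhds t) (nhds 0) := by
      have : Continuous (fun u : ℝ => σ * (u - t)) := by fun_prop
      simpa using this.tendsto t
    obtain ⟨δ, hδ, hball⟩ := Metric.eventually_nhds_iff.mp (h2.eventually h1)
    refine ⟨δ, hδ, fun u hu hu' => ?_⟩
    have := hball (y := u) (by rw [Real.dist_eq, abs_of_pos] <;> linarith)
    convert this using 2 <;> ring
  · intro t ht0 htr hp
    obtain ⟨⟨c, y⟩, hy⟩ := hout t ⟨ht0, lt_of_le_of_lt htr hrs⟩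
    have h1 := S.isometry hy
    have h2 : Filter.Tendsto (fun u : ℝ => σ * (u - t)) (nhds t) (nhds 0) := by
      have : Continuous (fun u : ℝ => σ * (u - t)) := by fun_prop
      simpa using this.tendsto t
    obtain ⟨δ, hδ, hball⟩ := Metric.eventually_nhds_iff.mp (h2.eventually h1)
    obtain ⟨u, hu1, hu2⟩ : ∃ u, max 0 (t - δ) < u ∧ u < t :=
      exists_between (max_lt ht0 (by linarith))
    have hu3 := (max_lt_iff.mp hu1)
    have h3 := hball (y := u) (by rw [Real.dist_eq, abs_lt]; constructor <;> linarith)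
    have h4 := hp u hu3.1.le hu2
    have h5 : b.2 + σ * t + σ * (u - t) = b.2 + σ * u := by ring
    rw [h5] at h3
    have h6 := S.right_unique h3 h4
    simp only [Prod.mk.injEq] at h6
    obtain ⟨h6, h7⟩ := h6
    subst h6
    have : y = b'.2 + S.sgn b.1 b'.1 * σ * t := by linarith
    rw [← this]
    exact hy

theorem exists_orbit {x : α × ℝ} (h : ∀ y, Relation.ReflTransGen S.Step x y → ∃ z, S.Step y z) :
    ∃ b : ℕ → α × ℝ, b 0 = x ∧ ∀ k, S.Step (b k) (b (k + 1)) := by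
  choose! f hf using h
  have hreach : ∀ k, Relation.ReflTransGen S.Step x (f^[k] x) := fun k => by
    induction k with
    | zero => exact .refl
    | succ k ih =>
      rw [Function.iterate_succ_apply']
      exact .tail ih (hf _ ih)
  refine ⟨fun k => f^[k] x, rfl, fun k => ?_⟩
  simp only [Function.iterate_succ_apply']
  exact hf _ (hreach k)

variable [Finite α]

/-- A one-sided gap of `K` at `b 0` is transported along the orbit. It is shortened only by points
without image, which happens finitely often; afterwards its length is constant. Infinitely many
distinct orbit points in intervals of bounded total length then force one of them, a point of `K`,
into the gap of another. -/
theorem no_gap_of_orbit {K : Set (α × ℝ)} (hinv : ∀ x y, S.Step x y → (x ∈ K ↔ y ∈ K))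
    {b : ℕ → α × ℝ} (hb : ∀ k, S.Step (b k) (b (k + 1))) (hb0 : b 0 ∈ K) {σ₀ s₀ : ℝ}
    (hσ₀ : σ₀ = 1 ∨ σ₀ = -1) (hs₀ : 0 < s₀)
    (hgap : ∀ s ∈ Ioo 0 s₀, (b 0).2 + σ₀ * s ∈ Ioo 0 (S.width (b 0).1) ∧
      ((b 0).1, (b 0).2 + σ₀ * s) ∉ K) : False := by
  have hbK : ∀ k, b k ∈ K := fun k => by
    induction k with
    | zero => exact hb0
    | succ k ih => exact (hinv _ _ (hb k)).mp ih
  have htrans : ∀ k m, Relation.TransGen S.Step (b k) (b (k + m + 1)) := fun k m => by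
    induction m with
    | zero => exact .single (hb k)
    | succ m ih => exact .tail ih (hb (k + m + 1))
  have hinj : Function.Injective b := by
    have key : ∀ k l, k < l → b k ≠ b l := by
      intro k l hkl h
      have := htrans k (l - k - 1)
      rw [show k + (l - k - 1) + 1 = l by omega, ← h] at this
      exact S.no_periodic _ this
    intro k l hkl
    by_contra hne
    rcases lt_or_gt_of_ne hne with h | h
    · exact key k l h hkl
    · exact key l k h hkl.symm
  -- `σ k` is the side of `b k` on which the transported gap lies.
  set σ : ℕ → ℝ := fun k => Nat.rec σ₀ (fun k r => S.sgn (b k).1 (b (k + 1)).1 * r) k with hσdef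
  have hσsucc : ∀ k, σ (k + 1) = S.sgn (b k).1 (b (k + 1)).1 * σ k := fun k => rfl
  have hσ : ∀ k, σ k = 1 ∨ σ k = -1 := fun k => by
    induction k with
    | zero => exact hσ₀
    | succ k ih =>
      rw [hσsucc]
      rcases S.sgn_eq (b k).1 (b (k + 1)).1 with h | h <;> rcases ih with h' | h' <;>
        rw [h, h'] <;> norm_num
  set Gap : ℕ → ℝ → Prop := fun k s => ∀ r ∈ Ioo 0 s,
    (b k).2 + σ k * r ∈ Ioo 0 (S.width (b k).1) ∧ ((b k).1, (b k).2 + σ k * r) ∉ K with hGap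
  have hmono : ∀ k s t, t ≤ s → Gap k s → Gap k t := fun k s t hts h r hr =>
    h r ⟨hr.1, lt_of_lt_of_le hr.2 hts⟩
  have hprop : ∀ k s, Gap k s → (∀ r ∈ Ioo 0 s, ∃ y, S.Step ((b k).1, (b k).2 + σ k * r) y) →
      Gap (k + 1) s := by
    intro k s hg hout r hr
    have h1 := S.step_along (hb k) hout r hr.1.le hr.2
    rw [← hσsucc] at h1
    exact ⟨S.mem_right h1, fun h => (hg r hr).2 ((hinv _ _ h1).mpr h)⟩
  have hpos : ∀ k, ∃ s > 0, Gap k s := fun k => by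
    induction k with
    | zero => exact ⟨s₀, hs₀, hgap⟩
    | succ k ih =>
      obtain ⟨s, hs, hg⟩ := ih
      have h1 := S.isometry (hb k)
      have h2 : Filter.Tendsto (fun u : ℝ => σ k * u) (nhds 0) (nhds 0) := by
        have : Continuous (fun u : ℝ => σ k * u) := by fun_prop
        simpa using this.tendsto 0
      obtain ⟨δ, hδ, hball⟩ := Metric.eventually_nhds_iff.mp (h2.eventually h1)
      refine ⟨min s δ, lt_min hs hδ, hprop k _ (hmono k _ _ (min_le_left _ _) hg) fun r hr => ?_⟩
      exact ⟨_, hball (y := r) (by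
        rw [Real.dist_eq, sub_zero, abs_of_pos hr.1]; exact lt_of_lt_of_le hr.2 (min_le_right _ _))⟩
  -- two orbit points with the same orientation never see each other through their gaps
  have hsee : ∀ k l s, (b k).1 = (b l).1 → σ k = σ l → Gap l s →
      ∀ r ∈ Ioo 0 s, (b k).2 ≠ (b l).2 + σ l * r := by
    intro k l s hkl hσkl hg r hr h
    refine (hg r hr).2 ?_
    rw [← h, ← hkl]
    exact hbK k
  set Sing : Set (α × ℝ) := {x | x.2 ∈ Ioo 0 (S.width x.1) ∧ ∀ y, ¬ S.Step x y}
  -- The index is bad if a point without image can be seen through the gap. That point and `σ k`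
  -- determine `b k`, since otherwise one orbit point would lie in the gap of another; hence there
  -- are finitely many bad indices.
  set Bad : Set ℕ := {k | ∃ r > 0, Gap k r ∧ ((b k).1, (b k).2 + σ k * r) ∈ Sing}
  have hBad : Bad.Finite := by
    choose! r hr0 hrg hrS using (fun k (hk : k ∈ Bad) => hk)
    refine Set.Finite.of_finite_image (f := fun k => (((b k).1, (b k).2 + σ k * r k), σ k)) ?_ ?_
    · refine (S.finite_out.prod ((Set.finite_singleton (1 : ℝ)).union
        (Set.finite_singleton (-1 : ℝ)))).subset ?_
      rintro _ ⟨k, hk, rfl⟩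
      exact ⟨hrS k hk, hσ k⟩
    · intro k hk l hl hkl
      simp only [Prod.mk.injEq] at hkl
      obtain ⟨⟨h1, h2⟩, h3⟩ := hkl
      apply hinj
      refine Prod.ext h1 ?_
      rw [h3] at h2
      rcases lt_trichotomy (r k) (r l) with h | h | h
      · exact absurd (by linear_combination h2) (hsee k l (r l) h1 h3 (hrg l hl) (r l - r k)
          ⟨by linarith, by linarith [hr0 k hk]⟩)
      · rw [h] at h2; linarith
      · exact absurd (by rw [h3]; linear_combination -h2) (hsee l k (r k) h1.symm h3.symm (hrg k hk)
          (r k - r l) ⟨by linarith, by linarith [hr0 l hl]⟩)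
  obtain ⟨N, hN⟩ := hBad.bddAbove
  obtain ⟨s, hs, hgs⟩ := hpos (N + 1)
  have hall : ∀ m, Gap (N + 1 + m) s := fun m => by
    induction m with
    | zero => exact hgs
    | succ m ih =>
      refine hprop _ s ih fun r hr => ?_
      by_contra! hno
      have : N + 1 + m ∈ Bad := ⟨r, hr.1, hmono _ _ _ hr.2.le ih, (ih r hr).1, hno⟩
      have := hN this
      omega
  obtain ⟨C, hC⟩ : ∃ C : ℝ, ∀ a, S.width a ≤ C := by
    obtain ⟨C, hC⟩ := (Set.finite_range S.width).bddAbove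
    exact ⟨C, fun a => hC ⟨a, rfl⟩⟩
  -- Pigeonhole on interval, orientation and cell of length `s`: two orbit points that agree in all
  -- three are closer than the gap length.
  have hfin : (Set.range fun m => ((b (N + 1 + m)).1, σ (N + 1 + m),
      ⌊(b (N + 1 + m)).2 / s⌋)).Finite := by
    refine (Set.finite_univ.prod (((Set.finite_singleton (1 : ℝ)).union
      (Set.finite_singleton (-1 : ℝ))).prod (Set.finite_Icc 0 ⌊C / s⌋))).subset ?_
    rintro _ ⟨m, rfl⟩
    have h1 := S.mem_left (hb (N + 1 + m))
    refine ⟨mem_univ _, hσ _, ?_, ?_⟩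
    · exact Int.floor_nonneg.mpr (div_nonneg h1.1.le hs.le)
    · apply Int.floor_le_floor
      have := hC (b (N + 1 + m)).1
      have := h1.2
      gcongr
      linarith
  have := hfin.to_subtype
  have hnotinj := not_injective_infinite_finite
    (Set.rangeFactorization fun m => ((b (N + 1 + m)).1, σ (N + 1 + m), ⌊(b (N + 1 + m)).2 / s⌋))
  simp only [Function.Injective, not_forall] at hnotinj
  obtain ⟨k, l, hkl, hne⟩ := hnotinj
  have hkl := congrArg Subtype.val hkl
  simp only [Set.rangeFactorization_coe, Prod.mk.injEq] at hkl
  obtain ⟨h1, h2, h3⟩ := hkl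
  have h4 := Int.abs_sub_lt_one_of_floor_eq_floor h3
  rw [← sub_div, abs_div, abs_of_pos hs, div_lt_one hs] at h4
  have hne' : (b (N + 1 + k)).2 ≠ (b (N + 1 + l)).2 := fun h => by
    have := hinj (Prod.ext h1 h)
    omega
  have h5 := hsee _ _ s h1 h2 (hall l)
  have h6 := hsee _ _ s h1.symm h2.symm (hall k)
  rw [abs_lt] at h4
  rw [h2] at h6
  rcases hσ (N + 1 + l) with h | h <;> rw [h] at h5 h6 <;> rcases lt_or_gt_of_ne hne' with h' | h'
  · exact h6 ((b (N + 1 + l)).2 - (b (N + 1 + k)).2) ⟨by linarith, by linarith⟩ (by ring)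
  · exact h5 ((b (N + 1 + k)).2 - (b (N + 1 + l)).2) ⟨by linarith, by linarith⟩ (by ring)
  · exact h5 ((b (N + 1 + l)).2 - (b (N + 1 + k)).2) ⟨by linarith, by linarith⟩ (by ring)
  · exact h6 ((b (N + 1 + k)).2 - (b (N + 1 + l)).2) ⟨by linarith, by linarith⟩ (by ring)

/-- If the orbit of `x` is infinite in neither direction, it runs from a point without preimage to a
point without image, which `no_connection` excludes; so the orbit argument applies to the map or to
its inverse. -/
theorem no_gap {K : Set (α × ℝ)} (hinv : ∀ x y, S.Step x y → (x ∈ K ↔ y ∈ K))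
    {x : α × ℝ} (hx : x ∈ K) (hxm : x.2 ∈ Ioo 0 (S.width x.1)) {σ₀ s₀ : ℝ}
    (hσ₀ : σ₀ = 1 ∨ σ₀ = -1) (hs₀ : 0 < s₀)
    (hgap : ∀ s ∈ Ioo 0 s₀, x.2 + σ₀ * s ∈ Ioo 0 (S.width x.1) ∧
      (x.1, x.2 + σ₀ * s) ∉ K) : False := by
  by_cases h : ∀ y, Relation.ReflTransGen S.Step x y → ∃ z, S.Step y z
  · obtain ⟨b, rfl, hb⟩ := S.exists_orbit h
    exact S.no_gap_of_orbit hinv hb hx hσ₀ hs₀ hgap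
  by_cases h' : ∀ y, Relation.ReflTransGen S.inverse.Step x y → ∃ z, S.inverse.Step y z
  · obtain ⟨b, rfl, hb⟩ := S.inverse.exists_orbit h'
    exact S.inverse.no_gap_of_orbit (fun x y h => (hinv y x h).symm) hb hx hσ₀ hs₀ hgap
  push Not at h h'
  obtain ⟨y, hxy, hy⟩ := h
  obtain ⟨w, hxw, hw⟩ := h'
  have hwx : Relation.ReflTransGen S.Step w x := Relation.reflTransGen_swap.mp hxw
  have hwm : w.2 ∈ Ioo 0 (S.width w.1) := by
    rcases hxw.cases_tail with h | ⟨z, -, hz⟩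
    · rw [h]; exact hxm
    · exact S.mem_left hz
  exact (S.no_connection hwm hw (hwx.trans hxy)).elim hy

/-- A relatively closed invariant set is a union of components. -/
theorem mem_of_invariant {K : Set (α × ℝ)} (hinv : ∀ x y, S.Step x y → (x ∈ K ↔ y ∈ K))
    (hclosed : ∀ a, ∀ s ∈ Ioo 0 (S.width a), (a, s) ∉ K → ∀ᶠ t in nhds s, (a, t) ∉ K)
    {a : α} {s t : ℝ} (hs : s ∈ Ioo 0 (S.width a)) (ht : t ∈ Ioo 0 (S.width a))
    (hsK : (a, s) ∈ K) : (a, t) ∈ K := by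
  by_contra htK
  obtain ⟨σ, R, hσ, hR, hst⟩ : ∃ σ R : ℝ, (σ = 1 ∨ σ = -1) ∧ 0 < R ∧ t = s + σ * R := by
    rcases lt_trichotomy s t with h | h | h
    · exact ⟨1, t - s, .inl rfl, by linarith, by ring⟩
    · exact absurd hsK (h ▸ htK)
    · exact ⟨-1, s - t, .inr rfl, by linarith, by ring⟩
  have hmem : ∀ r ∈ Icc 0 R, s + σ * r ∈ Ioo 0 (S.width a) := by
    intro r hr
    have h1 := hr.1
    have h2 := hr.2
    rcases hσ with rfl | rfl
    · exact ⟨by linarith [hs.1], by linarith [ht.2]⟩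
    · exact ⟨by linarith [ht.1], by linarith [hs.2]⟩
  -- Walk from `s` towards `t`. The last point of `K` on the way exists by closedness, and a gap
  -- follows it.
  set B : Set ℝ := {r | r ∈ Icc 0 R ∧ (a, s + σ * r) ∈ K}
  have hB : B.Nonempty := ⟨0, ⟨le_rfl, hR.le⟩, by simpa using hsK⟩
  have hbd : BddAbove B := ⟨R, fun r hr => hr.1.2⟩
  have hm : sSup B ∈ Icc 0 R := ⟨le_csSup hbd ⟨⟨le_rfl, hR.le⟩, by simpa using hsK⟩,
    csSup_le hB fun r hr => hr.1.2⟩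
  have hmK : (a, s + σ * sSup B) ∈ K := by
    by_contra hmK
    have h1 := hclosed a _ (hmem _ hm) hmK
    have h2 : Filter.Tendsto (fun u : ℝ => s + σ * u) (nhds (sSup B)) (nhds (s + σ * sSup B)) := by
      have : Continuous (fun u : ℝ => s + σ * u) := by fun_prop
      exact this.tendsto _
    obtain ⟨δ, hδ, hball⟩ := Metric.eventually_nhds_iff.mp (h2.eventually h1)
    obtain ⟨r, hrB, hr⟩ := exists_lt_of_lt_csSup hB (sub_lt_self (sSup B) hδ)
    have h3 := le_csSup hbd hrB
    exact hball (y := r) (by rw [Real.dist_eq, abs_lt]; constructor <;> linarith) hrB.2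
  have hmR : sSup B < R := by
    refine lt_of_le_of_ne hm.2 fun h => htK ?_
    rw [hst, ← h]
    exact hmK
  refine S.no_gap hinv hmK (hmem _ hm) hσ (sub_pos.mpr hmR) fun r hr => ?_
  have h4 : s + σ * sSup B + σ * r = s + σ * (sSup B + r) := by ring
  have h5 : sSup B + r ∈ Icc 0 R := ⟨by linarith [hm.1, hr.1], by linarith [hr.2]⟩
  simp only [h4]
  refine ⟨hmem _ h5, fun h => ?_⟩
  linarith [le_csSup hbd (⟨h5, h⟩ : sSup B + r ∈ B), hr.1]

end IntervalMap

/-! ### Signed areas and half-planes -/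

/-- The signed area of the parallelogram spanned by `u` and `z`. -/
def cross (u z : ℂ) : ℝ := u.re * z.im - u.im * z.re

theorem continuous_cross (u : ℂ) : Continuous (cross u) := by
  unfold cross
  exact (continuous_const.mul Complex.continuous_im).sub
    (continuous_const.mul Complex.continuous_re)

theorem cross_add (u z w : ℂ) : cross u (z + w) = cross u z + cross u w := by
  simp [cross]; ring

theorem cross_sub (u z w : ℂ) : cross u (z - w) = cross u z - cross u w := by
  simp [cross]; ring

theorem cross_neg (u z : ℂ) : cross u (-z) = -cross u z := by
  simp [cross]; ring

theorem cross_real_mul (u z : ℂ) (t : ℝ) : cross u (t * z) = t * cross u z := by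
  simp [cross]; ring

theorem cross_self_eq_zero (u : ℂ) : cross u u = 0 := by
  simp [cross]; ring

theorem cross_comm (u z : ℂ) : cross u z = -cross z u := by
  simp [cross]; ring

theorem exists_real_mul_of_cross_eq_zero {u z : ℂ} (hu : u ≠ 0) (h : cross u z = 0) :
    z = (((u.re * z.re + u.im * z.im) / Complex.normSq u : ℝ) : ℂ) * u := by
  have h1 : Complex.normSq u ≠ 0 := (Complex.normSq_pos.mpr hu).ne'
  unfold cross at h
  apply Complex.ext
  · simp only [Complex.mul_re, Complex.ofReal_re, Complex.ofReal_im]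
    field_simp
    rw [Complex.normSq_apply]
    linear_combination -u.im * h
  · simp only [Complex.mul_im, Complex.ofReal_re, Complex.ofReal_im]
    field_simp
    rw [Complex.normSq_apply]
    linear_combination u.re * h

theorem convex_cross_pos (d v : ℂ) (σ : ℝ) : Convex ℝ {w : ℂ | 0 < σ * cross d (w - v)} := by
  have h : {w : ℂ | 0 < σ * cross d (w - v)} = {w : ℂ | σ * cross d v < σ * cross d w} := by
    ext w
    simp only [mem_ofPred_eq, cross_sub]
    constructor <;> intro h <;> linarith
  rw [h]
  refine convex_halfSpace_gt ⟨fun x y => ?_, fun t x => ?_⟩ _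
  · rw [cross_add]; ring
  · rw [Complex.real_smul, cross_real_mul, smul_eq_mul]; ring

/-! ### The table near an open side -/

namespace PolygonalBilliard

variable (P : PolygonalBilliard)

instance : NeZero P.n := ⟨by have := P.three_le; omega⟩

/-- The vector along the `i`-th side. -/
def sideVec (i : ZMod P.n) : ℂ := P.vertex (i + 1) - P.vertex i

theorem sideVec_ne_zero (i : ZMod P.n) : P.sideVec i ≠ 0 :=
  sub_ne_zero.mpr (P.vertex_ne_succ i).symm

theorem mem_openSide_iff {i : ZMod P.n} {z : ℂ} :
    z ∈ P.openSide i ↔ ∃ t ∈ Ioo (0 : ℝ) 1, z = P.vertex i + t * P.sideVec i := by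
  unfold openSide
  rw [openSegment_eq_image']
  simp only [mem_image, Complex.real_smul, sideVec, eq_comm]

theorem mem_side_iff {i : ZMod P.n} {z : ℂ} :
    z ∈ segment ℝ (P.vertex i) (P.vertex (i + 1)) ↔
      ∃ t ∈ Icc (0 : ℝ) 1, z = P.vertex i + t * P.sideVec i := by
  rw [segment_eq_image']
  simp only [mem_image, Complex.real_smul, sideVec, eq_comm]

theorem cross_side {i : ZMod P.n} {z : ℂ} (h : z ∈ segment ℝ (P.vertex i) (P.vertex (i + 1))) :
    cross (P.sideVec i) (z - P.vertex i) = 0 := by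
  obtain ⟨t, -, rfl⟩ := P.mem_side_iff.mp h
  rw [add_sub_cancel_left, cross_real_mul, cross_self_eq_zero, mul_zero]

theorem openSide_subset_side (i : ZMod P.n) :
    P.openSide i ⊆ segment ℝ (P.vertex i) (P.vertex (i + 1)) :=
  openSegment_subset_segment ℝ _ _

theorem side_subset_frontier (i : ZMod P.n) :
    segment ℝ (P.vertex i) (P.vertex (i + 1)) ⊆ frontier P.table := by
  rw [P.frontier_table]
  exact subset_iUnion (fun i => segment ℝ (P.vertex i) (P.vertex (i + 1))) i

theorem openSide_subset_frontier (i : ZMod P.n) : P.openSide i ⊆ frontier P.table :=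
  (P.openSide_subset_side i).trans (P.side_subset_frontier i)

theorem vertex_mem_frontier (i : ZMod P.n) : P.vertex i ∈ frontier P.table :=
  P.side_subset_frontier i (left_mem_segment ℝ _ _)

theorem isClosed_table : IsClosed P.table := P.isCompact_table.isClosed

theorem frontier_subset_table : frontier P.table ⊆ P.table :=
  P.isClosed_table.frontier_subset

theorem notMem_interior_of_mem_frontier {z : ℂ} (h : z ∈ frontier P.table) :
    z ∉ interior P.table := h.2

theorem mem_frontier_iff {z : ℂ} :
    z ∈ frontier P.table ↔ z ∈ range P.vertex ∨ ∃ i, z ∈ P.openSide i := by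
  constructor
  · intro h
    rw [P.frontier_table] at h
    obtain ⟨i, hi⟩ := mem_iUnion.mp h
    by_cases h1 : z = P.vertex i
    · exact .inl ⟨i, h1.symm⟩
    by_cases h2 : z = P.vertex (i + 1)
    · exact .inl ⟨i + 1, h2.symm⟩
    · exact .inr ⟨i, mem_openSegment_of_ne_left_right (Ne.symm h1) (Ne.symm h2) hi⟩
  · rintro (⟨i, rfl⟩ | ⟨i, hi⟩)
    · exact P.vertex_mem_frontier i
    · exact P.openSide_subset_frontier i hi

theorem vertex_notMem_openSide (i j : ZMod P.n) : P.vertex j ∉ P.openSide i := by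
  intro h
  have h0 : P.vertex j ≠ P.vertex i := fun h' => by
    rw [h'] at h
    exact P.vertex_ne_succ i (left_mem_openSegment_iff.mp h)
  have h1 : P.vertex j ≠ P.vertex (i + 1) := fun h' => by
    rw [h'] at h
    exact P.vertex_ne_succ i (right_mem_openSegment_iff.mp h)
  have hji : j ≠ i := fun h' => h0 (h' ▸ rfl)
  have hji1 : j ≠ i + 1 := fun h' => h1 (h' ▸ rfl)
  have hi := P.openSide_subset_side i h
  by_cases h2 : i = j + 1
  · subst h2
    have : P.vertex j ∈ ({P.vertex (j + 1)} : Set ℂ) := by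
      rw [← P.side_inter_next j]
      exact ⟨left_mem_segment ℝ _ _, hi⟩
    exact h0 this
  · exact Set.disjoint_left.mp (P.side_disjoint i j hji hji1 h2) hi (left_mem_segment ℝ _ _)

theorem notMem_side_of_mem_openSide {i j : ZMod P.n} (hij : j ≠ i) {z : ℂ}
    (h : z ∈ P.openSide i) : z ∉ segment ℝ (P.vertex j) (P.vertex (j + 1)) := by
  intro hj
  have h1 : z ≠ P.vertex j := fun h' => P.vertex_notMem_openSide i j (h' ▸ h)
  have h2 : z ≠ P.vertex (j + 1) := fun h' => P.vertex_notMem_openSide i (j + 1) (h' ▸ h)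
  exact hij (P.openSide_unique (mem_openSegment_of_ne_left_right h1.symm h2.symm hj) h)

theorem eventually_mem_openSide {i : ZMod P.n} {x : ℂ} (hx : x ∈ P.openSide i) :
    ∀ᶠ w in nhds x, cross (P.sideVec i) (w - P.vertex i) = 0 → w ∈ P.openSide i := by
  set d := P.sideVec i with hd
  have hd0 : d ≠ 0 := P.sideVec_ne_zero i
  set f : ℂ → ℝ := fun w => (d.re * (w - P.vertex i).re + d.im * (w - P.vertex i).im) /
    Complex.normSq d with hf
  have hfc : Continuous f := by
    simp only [hf, Complex.sub_re, Complex.sub_im]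
    have := Complex.continuous_re
    have := Complex.continuous_im
    fun_prop
  have hfx : f x ∈ Ioo (0 : ℝ) 1 := by
    obtain ⟨t, ht, rfl⟩ := P.mem_openSide_iff.mp hx
    have : f (P.vertex i + t * d) = t := by
      have h1 : Complex.normSq d ≠ 0 := (Complex.normSq_pos.mpr hd0).ne'
      simp only [hf, add_sub_cancel_left, Complex.re_ofReal_mul, Complex.im_ofReal_mul]
      rw [div_eq_iff h1, Complex.normSq_apply]
      ring
    rwa [this]
  filter_upwards [hfc.continuousAt.eventually (isOpen_Ioo.mem_nhds hfx)] with w hw hw0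
  refine P.mem_openSide_iff.mpr ⟨f w, hw, ?_⟩
  have := exists_real_mul_of_cross_eq_zero hd0 hw0
  linear_combination this

/-- In a small disc the frontier is only the side, so each open half disc is connected off the
frontier and lies wholly inside or wholly outside. At least one is inside because the table is the
closure of its interior. -/
theorem exists_local_sign {i : ZMod P.n} {x : ℂ} (hx : x ∈ P.openSide i) :
    ∃ σ : ℝ, (σ = 1 ∨ σ = -1) ∧ ∀ᶠ w in nhds x,
      (w ∈ interior P.table ↔ 0 < σ * cross (P.sideVec i) (w - P.vertex i)) := by
  set d := P.sideVec i with hd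
  have h1 : ∀ᶠ w in nhds x, ∀ j, j ≠ i → w ∉ segment ℝ (P.vertex j) (P.vertex (j + 1)) := by
    rw [Filter.eventually_all]
    intro j
    by_cases hj : j = i
    · exact Filter.Eventually.of_forall fun w h => absurd hj h
    · have hcl : IsClosed (segment ℝ (P.vertex j) (P.vertex (j + 1))) := by
        rw [← closure_openSegment]; exact isClosed_closure
      filter_upwards [hcl.isOpen_compl.mem_nhds (P.notMem_side_of_mem_openSide hj hx)] with w hw _
      exact hw
  obtain ⟨ε, hε, hball⟩ := Metric.eventually_nhds_iff_ball.mp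
    (h1.and (P.eventually_mem_openSide hx))
  have hfr : ∀ w ∈ Metric.ball x ε, w ∈ frontier P.table → cross d (w - P.vertex i) = 0 := by
    intro w hw hwf
    rw [P.frontier_table] at hwf
    obtain ⟨j, hj⟩ := mem_iUnion.mp hwf
    by_cases hji : j = i
    · subst hji; exact P.cross_side hj
    · exact absurd hj ((hball w hw).1 j hji)
  have hhalf : ∀ σ : ℝ, (∃ w ∈ Metric.ball x ε, 0 < σ * cross d (w - P.vertex i) ∧ w ∈ P.table) →
      ∀ w ∈ Metric.ball x ε, 0 < σ * cross d (w - P.vertex i) → w ∈ interior P.table := by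
    rintro σ ⟨w₀, hw₀, hw₀σ, hw₀t⟩ w hw hwσ
    set H : Set ℂ := Metric.ball x ε ∩ {w | 0 < σ * cross d (w - P.vertex i)}
    have hH : IsPreconnected H :=
      ((convex_ball x ε).inter (convex_cross_pos d (P.vertex i) σ)).isPreconnected
    have hHf : ∀ w ∈ H, w ∉ frontier P.table := by
      rintro w ⟨hw, hw'⟩ hwf
      rw [mem_ofPred_eq, hfr w hw hwf, mul_zero] at hw'
      exact lt_irrefl _ hw'
    have hcov : ∀ y ∈ H, y ∈ P.table → y ∈ interior P.table := fun y hy hyt => by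
      by_contra hyi
      exact hHf y hy (by rw [P.isClosed_table.frontier_eq]; exact ⟨hyt, hyi⟩)
    have hsub : H ⊆ interior P.table :=
      hH.subset_left_of_subset_union isOpen_interior P.isClosed_table.isOpen_compl
      (disjoint_compl_right.mono_left interior_subset) (fun y hy =>
        (em (y ∈ P.table)).imp (hcov y hy) id) ⟨w₀, ⟨hw₀, hw₀σ⟩, hcov w₀ ⟨hw₀, hw₀σ⟩ hw₀t⟩
    exact hsub ⟨hw, hwσ⟩
  have hxt : x ∈ closure (interior P.table) := by
    rw [P.closure_interior_table]
    exact P.frontier_subset_table (P.openSide_subset_frontier i hx)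
  obtain ⟨w₀, hw₀i, hw₀⟩ := Metric.mem_closure_iff.mp hxt ε hε
  have hw₀b : w₀ ∈ Metric.ball x ε := by rwa [Metric.mem_ball, dist_comm]
  have hline : ∀ w ∈ Metric.ball x ε, w ∈ interior P.table → cross d (w - P.vertex i) ≠ 0 := by
    intro w hw hwi h0
    exact P.notMem_interior_of_mem_frontier
      (P.openSide_subset_frontier i ((hball w hw).2 h0)) hwi
  obtain ⟨σ, hσ, hσw⟩ : ∃ σ : ℝ, (σ = 1 ∨ σ = -1) ∧ 0 < σ * cross d (w₀ - P.vertex i) := by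
    rcases lt_or_gt_of_ne (hline w₀ hw₀b hw₀i) with h | h
    · exact ⟨-1, .inr rfl, by linarith⟩
    · exact ⟨1, .inl rfl, by linarith⟩
  have hpos := hhalf σ ⟨w₀, hw₀b, hσw, interior_subset hw₀i⟩
  refine ⟨σ, hσ, ?_⟩
  filter_upwards [Metric.ball_mem_nhds x hε] with w hw
  refine ⟨fun hwi => ?_, hpos w hw⟩
  by_contra hneg
  have hne := hline w hw hwi
  have hσ0 : σ ≠ 0 := by rcases hσ with h | h <;> rw [h] <;> norm_num
  have hneg' : 0 < -σ * cross d (w - P.vertex i) := by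
    have : σ * cross d (w - P.vertex i) ≠ 0 := mul_ne_zero hσ0 hne
    rcases lt_or_gt_of_ne this with h | h
    · linarith
    · exact absurd h hneg
  -- If both half discs were inside, the whole disc would lie in the table and `x` would be an
  -- interior point.
  have hpos' := hhalf (-σ) ⟨w, hw, hneg', interior_subset hwi⟩
  have hsub : Metric.ball x ε ⊆ P.table := by
    intro y hy
    rcases lt_trichotomy (σ * cross d (y - P.vertex i)) 0 with h | h | h
    · exact interior_subset (hpos' y hy (by linarith))
    · refine P.frontier_subset_table (P.openSide_subset_frontier i ((hball y hy).2 ?_))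
      exact (mul_eq_zero.mp h).resolve_left hσ0
    · exact interior_subset (hpos y hy h)
  exact P.notMem_interior_of_mem_frontier (P.openSide_subset_frontier i hx)
    (mem_interior.mpr ⟨_, hsub, Metric.isOpen_ball, Metric.mem_ball_self hε⟩)

/-- The local sign is locally constant and the open side is connected. The two signs exclude each
other, as seen by moving along the normal `I * d`. -/
theorem exists_sign (i : ZMod P.n) :
    ∃ σ : ℝ, (σ = 1 ∨ σ = -1) ∧ ∀ x ∈ P.openSide i, ∀ᶠ w in nhds x,
      (w ∈ interior P.table ↔ 0 < σ * cross (P.sideVec i) (w - P.vertex i)) := by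
  set d := P.sideVec i with hd
  set U : ℝ → Set ℂ := fun σ => {x | ∀ᶠ w in nhds x,
      (w ∈ interior P.table ↔ 0 < σ * cross d (w - P.vertex i))}
  have hU : ∀ σ, IsOpen (U σ) := fun σ => isOpen_setOfPred_eventually_nhds
  have hcov : P.openSide i ⊆ U 1 ∪ U (-1) := by
    intro x hx
    obtain ⟨σ, rfl | rfl, h⟩ := P.exists_local_sign hx
    · exact .inl h
    · exact .inr h
  have hdisj : P.openSide i ∩ (U 1 ∩ U (-1)) = ∅ := by
    rw [Set.eq_empty_iff_forall_notMem]
    rintro x ⟨hx, h1, h2⟩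
    have hxc : cross d (x - P.vertex i) = 0 := P.cross_side (P.openSide_subset_side i hx)
    have hd0 : 0 < Complex.normSq d := Complex.normSq_pos.mpr (P.sideVec_ne_zero i)
    have htend : Filter.Tendsto (fun t : ℝ => x + t * (Complex.I * d)) (nhds 0) (nhds x) := by
      have : Continuous (fun t : ℝ => x + t * (Complex.I * d)) := by fun_prop
      simpa using this.tendsto 0
    obtain ⟨δ, hδ, hb⟩ := Metric.eventually_nhds_iff.mp (htend.eventually (h1.and h2))
    have h3 := hb (y := δ / 2) (by rw [Real.dist_eq, sub_zero, abs_of_pos] <;> linarith)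
    have h4 : cross d (x + ((δ / 2 : ℝ) : ℂ) * (Complex.I * d) - P.vertex i) =
        δ / 2 * Complex.normSq d := by
      rw [add_sub_right_comm, cross_add, hxc, cross_real_mul, zero_add, Complex.normSq_apply]
      simp [cross]
    rw [h4] at h3
    have h5 : 0 < δ / 2 * Complex.normSq d := by positivity
    have h6 := h3.2.mp (h3.1.mpr (by linarith))
    linarith
  have hpre : IsPreconnected (P.openSide i) := (convex_openSegment _ _).isPreconnected
  rcases isPreconnected_iff_subset_of_disjoint.mp hpre _ _ (hU 1) (hU (-1)) hcov hdisj with h | h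
  · exact ⟨1, .inl rfl, fun x hx => h hx⟩
  · exact ⟨-1, .inr rfl, fun x hx => h hx⟩

/-- The sign for which `inSign i * cross (sideVec i)` is positive on inward vectors. -/
noncomputable def inSign (i : ZMod P.n) : ℝ := (P.exists_sign i).choose

theorem inSign_eq (i : ZMod P.n) : P.inSign i = 1 ∨ P.inSign i = -1 :=
  (P.exists_sign i).choose_spec.1

theorem inSign_mul_self (i : ZMod P.n) : P.inSign i * P.inSign i = 1 := by
  rcases P.inSign_eq i with h | h <;> rw [h] <;> norm_num

/-- The inward component of the vector `u` at the `i`-th side. -/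
noncomputable def inward (i : ZMod P.n) (u : ℂ) : ℝ := P.inSign i * cross (P.sideVec i) u

theorem continuous_inward (i : ZMod P.n) : Continuous (P.inward i) :=
  continuous_const.mul (continuous_cross _)

theorem inward_add (i : ZMod P.n) (u w : ℂ) : P.inward i (u + w) = P.inward i u + P.inward i w := by
  unfold inward; rw [cross_add]; ring

theorem inward_neg (i : ZMod P.n) (u : ℂ) : P.inward i (-u) = -P.inward i u := by
  unfold inward; rw [cross_neg]; ring

theorem inward_real_mul (i : ZMod P.n) (t : ℝ) (u : ℂ) :
    P.inward i (t * u) = t * P.inward i u := by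
  unfold inward; rw [cross_real_mul]; ring

theorem eventually_mem_interior_iff {i : ZMod P.n} {x : ℂ} (hx : x ∈ P.openSide i) :
    ∀ᶠ w in nhds x, (w ∈ interior P.table ↔ 0 < P.inward i (w - P.vertex i)) :=
  (P.exists_sign i).choose_spec.2 x hx

theorem inward_eq_zero_of_mem {i : ZMod P.n} {x : ℂ} (hx : x ∈ P.openSide i) :
    P.inward i (x - P.vertex i) = 0 := by
  unfold inward
  rw [P.cross_side (P.openSide_subset_side i hx), mul_zero]

theorem eventually_mem_openSide_of_inward {i : ZMod P.n} {x : ℂ} (hx : x ∈ P.openSide i) :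
    ∀ᶠ w in nhds x, P.inward i (w - P.vertex i) = 0 → w ∈ P.openSide i := by
  filter_upwards [P.eventually_mem_openSide hx] with w hw h
  refine hw ((mul_eq_zero.mp h).resolve_left ?_)
  rcases P.inSign_eq i with h | h <;> rw [h] <;> norm_num

end PolygonalBilliard

/-! ### Straight flights and their exits -/

namespace PolygonalBilliard

variable (P : PolygonalBilliard)

/-- The point `m` moves in the direction `u` inside the table until, at the time `τ`, it
arrives at the `j`-th open side. -/
def ExitsAt (m u : ℂ) (τ : ℝ) (j : ZMod P.n) : Prop :=
  0 < τ ∧ (∀ t ∈ Ico 0 τ, m + t * u ∈ interior P.table) ∧ m + τ * u ∈ P.openSide j ∧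
    P.inward j u < 0

/-- The direction `u` is not parallel to a side. -/
def Transverse (u : ℂ) : Prop := ∀ j, P.inward j u ≠ 0

variable {P}

theorem Transverse.ne_zero {u : ℂ} (hu : P.Transverse u) : u ≠ 0 := by
  rintro rfl
  exact hu 0 (by simp [inward, cross])

theorem Transverse.neg {u : ℂ} (hu : P.Transverse u) : P.Transverse (-u) := fun j => by
  rw [P.inward_neg]; exact neg_ne_zero.mpr (hu j)

theorem exists_exit {m u : ℂ} (hm : m ∈ interior P.table) (hu : u ≠ 0) :
    ∃ τ : ℝ, 0 < τ ∧ (∀ t ∈ Ico 0 τ, m + t * u ∈ interior P.table) ∧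
      m + τ * u ∈ frontier P.table := by
  have hcont : Continuous (fun t : ℝ => m + t * u) := by fun_prop
  set B : Set ℝ := {t | 0 ≤ t ∧ m + t * u ∉ interior P.table}
  have hBc : IsClosed B := isClosed_Ici.inter (isOpen_interior.preimage hcont).isClosed_compl
  have hBb : BddBelow B := ⟨0, fun t ht => ht.1⟩
  have hBn : B.Nonempty := by
    obtain ⟨R, hR⟩ := P.isCompact_table.isBounded.exists_norm_le
    have hu' : 0 < ‖u‖ := norm_pos_iff.mpr hu
    have hR0 : 0 ≤ R := (norm_nonneg m).trans (hR m (interior_subset hm))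
    refine ⟨(R + ‖m‖ + 1) / ‖u‖, by positivity, fun h => ?_⟩
    have h1 := hR _ (interior_subset h)
    have h2 : ‖(((R + ‖m‖ + 1) / ‖u‖ : ℝ) : ℂ) * u‖ = R + ‖m‖ + 1 := by
      rw [norm_mul, Complex.norm_real, Real.norm_of_nonneg (by positivity)]
      field_simp
    have h3 := norm_sub_le (m + (((R + ‖m‖ + 1) / ‖u‖ : ℝ) : ℂ) * u) m
    rw [add_sub_cancel_left, h2] at h3
    linarith
  have hτ := hBc.csInf_mem hBn hBb
  have hlt : ∀ t ∈ Ico 0 (sInf B), m + t * u ∈ interior P.table := by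
    intro t ht
    by_contra h
    exact absurd (csInf_le hBb (⟨ht.1, h⟩ : t ∈ B)) (not_le.mpr ht.2)
  have hpos : 0 < sInf B := by
    refine lt_of_le_of_ne hτ.1 fun h => hτ.2 ?_
    rw [← h]; simpa using hm
  refine ⟨sInf B, hpos, hlt, ?_⟩
  rw [P.isClosed_table.frontier_eq]
  refine ⟨?_, hτ.2⟩
  have h1 : sInf B ∈ closure (Ioo 0 (sInf B)) := by
    rw [closure_Ioo hpos.ne]; exact ⟨hpos.le, le_rfl⟩
  have h2 := map_mem_closure hcont h1 (t := P.table)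
    fun t ht => interior_subset (hlt t ⟨ht.1.le, ht.2⟩)
  rwa [P.isClosed_table.closure_eq] at h2

theorem eventually_move_mem_interior_iff {i : ZMod P.n} {x : ℂ} (hx : x ∈ P.openSide i) (u : ℂ) :
    ∃ δ > 0, ∀ t ∈ Ioo (0 : ℝ) δ, x + t * u ∈ interior P.table ↔ 0 < P.inward i u := by
  have hcont : Continuous (fun t : ℝ => x + t * u) := by fun_prop
  have ht : Filter.Tendsto (fun t : ℝ => x + t * u) (nhds 0) (nhds x) := by
    simpa using hcont.tendsto 0
  obtain ⟨δ, hδ, h⟩ := Metric.eventually_nhds_iff.mp (ht.eventually (P.eventually_mem_interior_iff hx))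
  refine ⟨δ, hδ, fun t ht => ?_⟩
  rw [h (by rw [Real.dist_eq, sub_zero, abs_of_pos ht.1]; exact ht.2), add_sub_right_comm,
    P.inward_add, P.inward_eq_zero_of_mem hx, P.inward_real_mul, zero_add, mul_pos_iff_of_pos_left ht.1]

theorem exitsAt_of_mem_openSide {m u : ℂ} {τ : ℝ} {j : ZMod P.n} (hu : P.Transverse u)
    (hτ : 0 < τ) (h : ∀ t ∈ Ico 0 τ, m + t * u ∈ interior P.table)
    (hj : m + τ * u ∈ P.openSide j) : P.ExitsAt m u τ j := by
  refine ⟨hτ, h, hj, lt_of_le_of_ne ?_ (hu j)⟩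
  obtain ⟨δ, hδ, hδ'⟩ := P.eventually_move_mem_interior_iff hj (-u)
  obtain ⟨t, ht⟩ := exists_between (lt_min hδ hτ)
  have h1 := (hδ' t ⟨ht.1, (lt_min_iff.mp ht.2).1⟩).mp (by
    have := h (τ - t) ⟨by linarith [(lt_min_iff.mp ht.2).2], by linarith⟩
    convert this using 1
    push_cast; ring)
  rw [P.inward_neg] at h1
  linarith

theorem exists_exitsAt_or_vertex {m u : ℂ} (hm : m ∈ interior P.table) (hu : P.Transverse u) :
    (∃ τ j, P.ExitsAt m u τ j) ∨ ∃ (τ : ℝ) (k : ZMod P.n), 0 < τ ∧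
      (∀ t ∈ Ico 0 τ, m + t * u ∈ interior P.table) ∧ m + τ * u = P.vertex k := by
  obtain ⟨τ, hτ, h, hf⟩ := P.exists_exit hm hu.ne_zero
  rcases P.mem_frontier_iff.mp hf with ⟨k, hk⟩ | ⟨j, hj⟩
  · exact .inr ⟨τ, k, hτ, h, hk.symm⟩
  · exact .inl ⟨τ, j, P.exitsAt_of_mem_openSide hu hτ h hj⟩

theorem exit_time_unique {m u : ℂ} {τ τ' : ℝ} (hτ : 0 < τ) (hτ' : 0 < τ')
    (h : ∀ t ∈ Ioo 0 τ, m + t * u ∈ interior P.table)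
    (h' : ∀ t ∈ Ioo 0 τ', m + t * u ∈ interior P.table)
    (hf : m + τ * u ∈ frontier P.table) (hf' : m + τ' * u ∈ frontier P.table) : τ = τ' := by
  rcases lt_trichotomy τ τ' with hlt | heq | hlt
  · exact absurd (h' τ ⟨hτ, hlt⟩) (P.notMem_interior_of_mem_frontier hf)
  · exact heq
  · exact absurd (h τ' ⟨hτ', hlt⟩) (P.notMem_interior_of_mem_frontier hf')

/-- The new exit time `f m'` solves the linear equation of the line through the side. Until `τ - δ /
2` the flight stays inside by compactness; near the exit point the table is a half-plane. -/
theorem ExitsAt.eventually {m u : ℂ} {τ : ℝ} {j : ZMod P.n} (h : P.ExitsAt m u τ j) :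
    ∀ᶠ m' in nhds m, ∃ τ', P.ExitsAt m' u τ' j := by
  obtain ⟨hτ, hint, hx, hneg⟩ := h
  set f : ℂ → ℝ := fun m' => -P.inward j (m' - P.vertex j) / P.inward j u with hf
  have hfc : Continuous f := by
    have := P.continuous_inward j
    exact ((this.comp (continuous_id.sub continuous_const)).neg).div_const _
  have hfm : f m = τ := by
    have h1 := P.inward_eq_zero_of_mem hx
    rw [add_sub_right_comm, P.inward_add, P.inward_real_mul] at h1
    rw [hf]
    simp only
    rw [div_eq_iff hneg.ne]
    linarith
  have hg : Continuous (fun q : ℂ × ℝ => q.1 + q.2 * u) := by fun_prop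
  obtain ⟨δ, hδ, hloc⟩ := Metric.eventually_nhds_iff.mp (((hg.tendsto (m, τ)).eventually
    ((P.eventually_mem_interior_iff hx).and (P.eventually_mem_openSide_of_inward hx))))
  have hcpt : ∀ᶠ m' in nhds m, ∀ t ∈ Icc (0 : ℝ) (τ - δ / 2), m' + t * u ∈ interior P.table := by
    refine isCompact_Icc.eventually_forall_of_forall_eventually fun t ht => ?_
    exact (hg.tendsto (m, t)).eventually
      (isOpen_interior.mem_nhds (hint t ⟨ht.1, by linarith [ht.2]⟩))
  have hf1 : ∀ᶠ m' in nhds m, 0 < f m' ∧ |f m' - τ| < δ := by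
    refine (hfc.continuousAt.eventually (lt_mem_nhds (hfm ▸ hτ))).and ?_
    have h2 := hfc.continuousAt.eventually (Metric.ball_mem_nhds (f m) hδ)
    filter_upwards [h2] with m' hm'
    rwa [hfm, Real.dist_eq] at hm'
  filter_upwards [hcpt, hf1, Metric.ball_mem_nhds m hδ] with m' h1 h2 h3
  have hval : ∀ t : ℝ, P.inward j (m' + t * u - P.vertex j) = (t - f m') * P.inward j u := by
    intro t
    rw [add_sub_right_comm, P.inward_add, P.inward_real_mul, hf]
    have := hneg.ne
    field_simp
    ring
  have hloc' : ∀ t : ℝ, |t - τ| < δ →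
      (m' + t * u ∈ interior P.table ↔ 0 < P.inward j (m' + t * u - P.vertex j)) ∧
      (P.inward j (m' + t * u - P.vertex j) = 0 → m' + t * u ∈ P.openSide j) := fun t ht =>
    hloc (y := (m', t)) (by
      rw [Prod.dist_eq]; exact max_lt (Metric.mem_ball.mp h3) (by rwa [Real.dist_eq]))
  refine ⟨f m', h2.1, fun t ht => ?_, (hloc' _ h2.2).2 (by rw [hval, sub_self, zero_mul]), hneg⟩
  by_cases htδ : t ≤ τ - δ / 2
  · exact h1 t ⟨ht.1, htδ⟩
  · have h4 := abs_lt.mp h2.2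
    refine (hloc' t ?_).1.mpr ?_
    · rw [abs_lt]; constructor <;> linarith [ht.2]
    · rw [hval]
      exact mul_pos_of_neg_of_neg (by linarith [ht.2]) hneg

end PolygonalBilliard

theorem cross_eq_im (u z : ℂ) : cross u z = (starRingEnd ℂ u * z).im := by
  simp [cross]; ring

/-! ### Reflections, unfolding and generic directions -/

namespace PolygonalBilliard

variable (P : PolygonalBilliard)

/-- The linear reflection in the direction of the `i`-th side. -/
noncomputable def lin (i : ZMod P.n) (u : ℂ) : ℂ :=
  P.sideVec i / starRingEnd ℂ (P.sideVec i) * starRingEnd ℂ u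

/-- The reflection in the line through the `i`-th side. -/
noncomputable def refl (i : ZMod P.n) (z : ℂ) : ℂ := P.vertex i + P.lin i (z - P.vertex i)

theorem conj_sideVec_ne_zero (i : ZMod P.n) : starRingEnd ℂ (P.sideVec i) ≠ 0 :=
  (map_ne_zero _).mpr (P.sideVec_ne_zero i)

theorem lin_add (i : ZMod P.n) (u w : ℂ) : P.lin i (u + w) = P.lin i u + P.lin i w := by
  simp only [lin, map_add]; ring

theorem lin_neg (i : ZMod P.n) (u : ℂ) : P.lin i (-u) = -P.lin i u := by
  simp only [lin, map_neg]; ring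

theorem lin_real_mul (i : ZMod P.n) (t : ℝ) (u : ℂ) : P.lin i (t * u) = t * P.lin i u := by
  simp only [lin, map_mul, Complex.conj_ofReal]; ring

theorem lin_lin (i : ZMod P.n) (u : ℂ) : P.lin i (P.lin i u) = u := by
  have h1 := P.sideVec_ne_zero i
  have h2 := P.conj_sideVec_ne_zero i
  simp only [lin, map_mul, map_div₀, Complex.conj_conj]
  field_simp

theorem lin_sideVec (i : ZMod P.n) : P.lin i (P.sideVec i) = P.sideVec i := by
  have h2 := P.conj_sideVec_ne_zero i
  simp only [lin]
  field_simp

theorem inward_lin (i : ZMod P.n) (u : ℂ) : P.inward i (P.lin i u) = -P.inward i u := by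
  have h2 := P.conj_sideVec_ne_zero i
  have : starRingEnd ℂ (P.sideVec i) * P.lin i u =
      starRingEnd ℂ (starRingEnd ℂ (P.sideVec i) * u) := by
    simp only [lin, map_mul, Complex.conj_conj]
    field_simp
  rw [inward, inward, cross_eq_im, cross_eq_im, this, Complex.conj_im]
  ring

theorem abs_cross_lin (i : ZMod P.n) (u w : ℂ) :
    |cross (P.lin i u) (P.lin i w)| = |cross u w| := by
  have h1 := P.sideVec_ne_zero i
  have h2 := P.conj_sideVec_ne_zero i
  have : starRingEnd ℂ (P.lin i u) * P.lin i w = starRingEnd ℂ (starRingEnd ℂ u * w) := by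
    simp only [lin, map_mul, map_div₀, Complex.conj_conj]
    field_simp
  rw [cross_eq_im, cross_eq_im, this, Complex.conj_im, abs_neg]

theorem refl_add (i : ZMod P.n) (z u : ℂ) : P.refl i (z + u) = P.refl i z + P.lin i u := by
  rw [refl, refl, add_sub_right_comm, lin_add, add_assoc]

theorem refl_refl (i : ZMod P.n) (z : ℂ) : P.refl i (P.refl i z) = z := by
  rw [refl, refl, add_sub_cancel_left, lin_lin]; ring

theorem refl_of_mem_openSide {i : ZMod P.n} {z : ℂ} (h : z ∈ P.openSide i) : P.refl i z = z := by
  obtain ⟨t, -, rfl⟩ := P.mem_openSide_iff.mp h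
  rw [refl, add_sub_cancel_left, lin_real_mul, lin_sideVec]

/-- The composition of the reflections in the listed sides. -/
noncomputable def word : List (ZMod P.n) → ℂ → ℂ
  | [], z => z
  | i :: L, z => P.refl i (word L z)

/-- The linear part of `word`. -/
noncomputable def linWord : List (ZMod P.n) → ℂ → ℂ
  | [], u => u
  | i :: L, u => P.lin i (linWord L u)

theorem word_append (L L' : List (ZMod P.n)) (z : ℂ) :
    P.word (L ++ L') z = P.word L (P.word L' z) := by
  induction L with
  | nil => rfl
  | cons i L ih => simp [word, ih]

theorem linWord_append (L L' : List (ZMod P.n)) (z : ℂ) :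
    P.linWord (L ++ L') z = P.linWord L (P.linWord L' z) := by
  induction L with
  | nil => rfl
  | cons i L ih => simp [linWord, ih]

theorem word_add_real_mul (L : List (ZMod P.n)) (z u : ℂ) (t : ℝ) :
    P.word L (z + t * u) = P.word L z + t * P.linWord L u := by
  induction L with
  | nil => rfl
  | cons i L ih => simp [word, linWord, ih, refl_add, lin_real_mul]

theorem word_add (L : List (ZMod P.n)) (z u : ℂ) :
    P.word L (z + u) = P.word L z + P.linWord L u := by
  simpa using P.word_add_real_mul L z u 1

theorem word_reverse_word (L : List (ZMod P.n)) (z : ℂ) : P.word L.reverse (P.word L z) = z := by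
  induction L with
  | nil => rfl
  | cons i L ih => simp [word, word_append, refl_refl, ih]

theorem linWord_reverse_linWord (L : List (ZMod P.n)) (z : ℂ) :
    P.linWord L.reverse (P.linWord L z) = z := by
  induction L with
  | nil => rfl
  | cons i L ih => simp [linWord, linWord_append, lin_lin, ih]

/-- No two images of corners under the group generated by the reflections in the sides differ by a
nonzero multiple of `u`. -/
def Generic (u : ℂ) : Prop := u ≠ 0 ∧ ∀ (L L' : List (ZMod P.n)) (k l : ZMod P.n) (t : ℝ),
  P.word L (P.vertex k) - P.word L' (P.vertex l) = t * u → t = 0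

variable {P}

theorem Generic.linWord {u : ℂ} (h : P.Generic u) (M : List (ZMod P.n)) :
    P.Generic (P.linWord M u) := by
  constructor
  · intro h0
    have h1 := P.linWord_reverse_linWord M u
    have h2 := P.word_add_real_mul M.reverse 0 0 0
    have h3 := P.word_add M.reverse 0 0
    rw [h0] at h1
    simp at h3
    exact h.1 (h1.symm.trans h3)
  · intro L L' k l t ht
    refine h.2 (M.reverse ++ L) (M.reverse ++ L') k l t ?_
    rw [word_append, word_append, ← sub_add_cancel (P.word L (P.vertex k)) (P.word L' (P.vertex l)),
      ht, add_comm, word_add_real_mul, linWord_reverse_linWord, add_sub_cancel_left]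

theorem Generic.neg {u : ℂ} (h : P.Generic u) : P.Generic (-u) := by
  refine ⟨neg_ne_zero.mpr h.1, fun L L' k l t ht => ?_⟩
  have := h.2 L L' k l (-t) (by rw [ht]; push_cast; ring)
  linarith

/-- A side vector is itself the difference of two corners. -/
theorem Generic.transverse {u : ℂ} (h : P.Generic u) : P.Transverse u := by
  intro j hj
  have h1 : cross u (P.sideVec j) = 0 := by
    rw [cross_comm, neg_eq_zero]
    refine (mul_eq_zero.mp hj).resolve_left ?_
    rcases P.inSign_eq j with h | h <;> rw [h] <;> norm_num
  have h2 := exists_real_mul_of_cross_eq_zero h.1 h1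
  have h3 := h.2 [] [] (j + 1) j _ h2
  rw [h3] at h2
  exact P.sideVec_ne_zero j (by simpa using h2)

variable (P)

/-- A finite set of generic directions that is stable under the reflections in the sides. -/
structure DirectionSet where
  dirs : Set ℂ
  finite : dirs.Finite
  generic : ∀ u ∈ dirs, P.Generic u
  lin_mem : ∀ u ∈ dirs, ∀ i, P.lin i u ∈ dirs

/-! ### The billiard map in coordinates across the beams -/

namespace DirectionSet

variable {P} (D : P.DirectionSet)

/-- The pairs of a side and an inward direction. -/
def Label : Type := {a : ZMod P.n × ℂ // a.2 ∈ D.dirs ∧ 0 < P.inward a.1 a.2}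

variable {D}

/-- The side of a label. -/
def Label.side (a : D.Label) : ZMod P.n := a.1.1

/-- The direction of a label. -/
def Label.dir (a : D.Label) : ℂ := a.1.2

theorem Label.ext {a b : D.Label} (h : a.side = b.side) (h' : a.dir = b.dir) : a = b :=
  Subtype.ext (Prod.ext h h')

instance : Finite D.Label := by
  refine Set.Finite.to_subtype (s := {a : ZMod P.n × ℂ | a.2 ∈ D.dirs ∧ 0 < P.inward a.1 a.2})
    ((Set.finite_univ.prod D.finite).subset fun a ha => ⟨mem_univ _, ha.1⟩)

theorem Label.dir_mem (a : D.Label) : a.dir ∈ D.dirs := a.2.1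

theorem Label.generic (a : D.Label) : P.Generic a.dir := D.generic _ a.dir_mem

/-- The width of the beam of orbits that leave the side of `a` in the direction of `a`. -/
noncomputable def Label.width (a : D.Label) : ℝ := P.inward a.side a.dir

theorem Label.width_pos (a : D.Label) : 0 < a.width := a.2.2

/-- The point of the side at the distance `s` from the first corner, measured across the beam. -/
noncomputable def point (x : D.Label × ℝ) : ℂ :=
  P.vertex x.1.side + ((x.2 / x.1.width : ℝ) : ℂ) * P.sideVec x.1.side

theorem point_mem {x : D.Label × ℝ} (hx : x.2 ∈ Ioo 0 x.1.width) :
    point x ∈ P.openSide x.1.side := by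
  have := x.1.width_pos
  exact P.mem_openSide_iff.mpr ⟨_, ⟨div_pos hx.1 this, (div_lt_one this).mpr hx.2⟩, rfl⟩

theorem exists_point (a : D.Label) {z : ℂ} (hz : z ∈ P.openSide a.side) :
    ∃ s ∈ Ioo 0 a.width, point (a, s) = z := by
  obtain ⟨t, ht, rfl⟩ := P.mem_openSide_iff.mp hz
  have := a.width_pos
  refine ⟨t * a.width, ⟨by have := ht.1; positivity, by nlinarith [ht.2]⟩, ?_⟩
  simp only [point]
  rw [mul_div_cancel_right₀ _ this.ne']

theorem point_add (a : D.Label) (s h : ℝ) :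
    point (a, s + h) = point (a, s) + ((h / a.width : ℝ) : ℂ) * P.sideVec a.side := by
  simp only [point, add_div]; push_cast; ring

theorem cross_dir_sideVec (a : D.Label) :
    cross a.dir (P.sideVec a.side) = -P.inSign a.side * a.width := by
  rw [cross_comm, Label.width, inward]
  linear_combination cross (P.sideVec a.side) a.dir * P.inSign_mul_self a.side

theorem cross_lin_dir_sideVec (a : D.Label) :
    cross (P.lin a.side a.dir) (P.sideVec a.side) = P.inSign a.side * a.width := by
  have h := P.inward_lin a.side a.dir
  rw [cross_comm, Label.width]
  rw [inward] at h
  linear_combination -P.inSign a.side * h +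
    cross (P.sideVec a.side) (P.lin a.side a.dir) * P.inSign_mul_self a.side

theorem state_ext {x y : D.Label × ℝ} (hx : x.2 ∈ Ioo 0 x.1.width) (hy : y.2 ∈ Ioo 0 y.1.width)
    (hdir : x.1.dir = y.1.dir) (h : point x = point y) : x = y := by
  obtain ⟨a, s⟩ := x
  obtain ⟨b, t⟩ := y
  have hab : a = b := by
    refine Label.ext (P.openSide_unique (point_mem hx) ?_) hdir
    rw [h]
    exact point_mem hy
  subst hab
  have h1 := point_add a t (s - t)
  rw [add_sub_cancel, h, left_eq_add, mul_eq_zero, or_iff_left (P.sideVec_ne_zero _),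
    Complex.ofReal_eq_zero, div_eq_zero_iff, or_iff_left a.width_pos.ne'] at h1
  rw [sub_eq_zero.mp h1]

/-- The state `y` is the next state after `x` at which the billiard orbit leaves a side. -/
def Bounce (x y : D.Label × ℝ) : Prop :=
  x.2 ∈ Ioo 0 x.1.width ∧ y.2 ∈ Ioo 0 y.1.width ∧ y.1.dir = P.lin y.1.side x.1.dir ∧
    ∃ τ : ℝ, 0 < τ ∧ point y = point x + τ * x.1.dir ∧
      ∀ t ∈ Ioo 0 τ, point x + t * x.1.dir ∈ interior P.table

theorem point_mem_frontier {x : D.Label × ℝ} (hx : x.2 ∈ Ioo 0 x.1.width) :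
    point x ∈ frontier P.table := P.openSide_subset_frontier _ (point_mem hx)

theorem Bounce.right_unique {x y z : D.Label × ℝ} (h : Bounce x y) (h' : Bounce x z) : y = z := by
  obtain ⟨hx, hy, hyd, τ, hτ, hyp, hyi⟩ := h
  obtain ⟨-, hz, hzd, τ', hτ', hzp, hzi⟩ := h'
  have := P.exit_time_unique hτ hτ' hyi hzi (hyp ▸ point_mem_frontier hy)
    (hzp ▸ point_mem_frontier hz)
  subst this
  have hp : point y = point z := hyp.trans hzp.symm
  have hs : y.1.side = z.1.side := P.openSide_unique (point_mem hy) (hp ▸ point_mem hz)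
  exact state_ext hy hz (by rw [hyd, hzd, hs]) hp

theorem Bounce.left_unique {x y z : D.Label × ℝ} (h : Bounce x z) (h' : Bounce y z) : x = y := by
  obtain ⟨hx, hz, hxd, τ, hτ, hxp, hxi⟩ := h
  obtain ⟨hy, -, hyd, τ', hτ', hyp, hyi⟩ := h'
  have hd : x.1.dir = y.1.dir := by
    rw [← P.lin_lin z.1.side x.1.dir, ← hxd, hyd, P.lin_lin]
  have h1 : point x = point z + τ * (-x.1.dir) := by rw [hxp]; ring
  have h2 : point y = point z + τ' * (-x.1.dir) := by rw [hyp, hd]; ring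
  have := P.exit_time_unique (m := point z) (u := -x.1.dir) hτ hτ'
    (fun t ht => by
      have := hxi (τ - t) ⟨by linarith [ht.2], by linarith [ht.1]⟩
      rw [h1] at this
      convert this using 1
      push_cast; ring)
    (fun t ht => by
      have := hyi (τ' - t) ⟨by linarith [ht.2], by linarith [ht.1]⟩
      rw [h2, ← hd] at this
      convert this using 1
      push_cast; ring)
    (h1 ▸ point_mem_frontier hx) (h2 ▸ point_mem_frontier hy)
  subst this
  exact state_ext hx hy hd (h1.trans h2.symm)

/-- Seen from its midpoint, a flight has two exits, so the stability of `ExitsAt` controls both ends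
at once. -/
theorem Bounce.exists_exitsAt {x y : D.Label × ℝ} (h : Bounce x y) :
    ∃ (m : ℂ) (τ : ℝ), P.ExitsAt m x.1.dir τ y.1.side ∧ P.ExitsAt m (-x.1.dir) τ x.1.side ∧
      point y = m + τ * x.1.dir ∧ point x = m + τ * (-x.1.dir) := by
  obtain ⟨hx, hy, hyd, τ, hτ, hyp, hyi⟩ := h
  have hu := x.1.generic.transverse
  have h1 : point x + (τ / 2 : ℝ) * x.1.dir + (τ / 2 : ℝ) * x.1.dir = point y := by
    rw [hyp]; push_cast; ring
  have h2 : point x + (τ / 2 : ℝ) * x.1.dir + (τ / 2 : ℝ) * (-x.1.dir) = point x := by ring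
  refine ⟨point x + (τ / 2 : ℝ) * x.1.dir, τ / 2, ?_, ?_, h1.symm, h2.symm⟩
  · refine P.exitsAt_of_mem_openSide hu (by linarith) (fun t ht => ?_) (h1 ▸ point_mem hy)
    convert hyi (τ / 2 + t) ⟨by linarith [ht.1], by linarith [ht.2]⟩ using 1
    push_cast; ring
  · refine P.exitsAt_of_mem_openSide hu.neg (by linarith) (fun t ht => ?_) (by rw [h2]; exact point_mem hx)
    convert hyi (τ / 2 - t) ⟨by linarith [ht.2], by linarith [ht.1]⟩ using 1
    push_cast; ring

theorem bounce_of_exitsAt {x y : D.Label × ℝ} (hx : x.2 ∈ Ioo 0 x.1.width)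
    (hy : y.2 ∈ Ioo 0 y.1.width) (hd : y.1.dir = P.lin y.1.side x.1.dir) {m : ℂ} {τ τ' : ℝ}
    {i j : ZMod P.n} (h : P.ExitsAt m x.1.dir τ j) (h' : P.ExitsAt m (-x.1.dir) τ' i)
    (hyp : point y = m + τ * x.1.dir) (hxp : point x = m + τ' * (-x.1.dir)) : Bounce x y := by
  refine ⟨hx, hy, hd, τ' + τ, add_pos h'.1 h.1, by rw [hyp, hxp]; push_cast; ring, fun t ht => ?_⟩
  rcases lt_or_ge t τ' with h1 | h1
  · convert h'.2.1 (τ' - t) ⟨by linarith, by linarith [ht.1]⟩ using 1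
    rw [hxp]; push_cast; ring
  · convert h.2.1 (t - τ') ⟨by linarith, by linarith [ht.2]⟩ using 1
    rw [hxp]; push_cast; ring

/-- Translate the midpoint along the side of `a`; both exits persist. The product `cross a.dir` is
constant along a flight and reads off the coordinate across the beam at either end up to sign, so
the map is an isometry in this coordinate. -/
theorem Bounce.eventually {a b : D.Label} {s t : ℝ} (h : Bounce (a, s) (b, t)) :
    ∀ᶠ r in nhds (0 : ℝ), Bounce (a, s + r) (b, t + -(P.inSign a.side * P.inSign b.side) * r) := by
  obtain ⟨m, τ, hf, hb, hpf, hpb⟩ := h.exists_exitsAt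
  have hmove : Filter.Tendsto (fun r : ℝ => m + ((r / a.width : ℝ) : ℂ) * P.sideVec a.side)
      (nhds 0) (nhds m) := by
    have : Continuous (fun r : ℝ => m + ((r / a.width : ℝ) : ℂ) * P.sideVec a.side) := by fun_prop
    simpa using this.tendsto 0
  have hr : ∀ᶠ r in nhds (0 : ℝ), s + r ∈ Ioo 0 a.width := by
    have : Continuous (fun r : ℝ => s + r) := by fun_prop
    exact this.continuousAt.eventually (isOpen_Ioo.mem_nhds (by simpa using h.1))
  filter_upwards [hmove.eventually hf.eventually, hmove.eventually hb.eventually, hr]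
    with r ⟨τ₁, hf'⟩ ⟨τ₂, hb'⟩ hr
  set m' := m + ((r / a.width : ℝ) : ℂ) * P.sideVec a.side with hm'
  simp only at hf hb hpf hpb
  have hx : point (a, s + r) = m' + τ * (-a.dir) := by
    rw [point_add, hpb, hm']; ring
  have hx' : point (a, s + r) = m' + τ₂ * (-a.dir) := by
    have h1 := P.inward_eq_zero_of_mem (point_mem (x := (a, s + r)) hr)
    have h2 := P.inward_eq_zero_of_mem hb'.2.2.1
    rw [hx] at h1
    simp only at h1 h2
    rw [add_sub_right_comm, P.inward_add, P.inward_real_mul] at h1 h2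
    have h3 : (τ - τ₂) * P.inward a.side (-a.dir) = 0 := by linarith
    have h4 := (mul_eq_zero.mp h3).resolve_right hb'.2.2.2.ne
    rw [hx, sub_eq_zero.mp h4]
  obtain ⟨t', ht', hy⟩ := exists_point b hf'.2.2.1
  have hwa := a.width_pos.ne'
  have hwb := b.width_pos.ne'
  have key : t' = t + -(P.inSign a.side * P.inSign b.side) * r := by
    have h1 := point_add b t (t' - t)
    rw [add_sub_cancel, hy, hpf, hm'] at h1
    have h2 := congrArg (cross a.dir) h1
    simp only [cross_add, cross_real_mul, cross_self_eq_zero] at h2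
    have h3 := cross_dir_sideVec a
    have h4 := cross_lin_dir_sideVec b
    have h5 : b.dir = P.lin b.side a.dir := h.2.2.1
    rw [h5, P.lin_lin] at h4
    rw [h3, h4] at h2
    field_simp at h2
    linear_combination -P.inSign b.side * h2 - (t' - t) * P.inSign_mul_self b.side
  rw [← key]
  exact bounce_of_exitsAt hr ht' h.2.2.1 hf' hb' hy hx'

/-- For each label and corner, the line through the corner in the direction `f a` is transverse to
the side, so `cross (f a)` determines the coordinate. -/
theorem finite_vertex_hits (f : D.Label → ℂ) (hf : ∀ a, cross (f a) (P.sideVec a.side) ≠ 0) :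
    {x : D.Label × ℝ | ∃ (τ : ℝ) (k : ZMod P.n), point x + τ * f x.1 = P.vertex k}.Finite := by
  refine (Set.finite_range fun q : D.Label × ZMod P.n => (q.1,
    (cross (f q.1) (P.vertex q.2) - cross (f q.1) (P.vertex q.1.side)) * q.1.width /
      cross (f q.1) (P.sideVec q.1.side))).subset ?_
  rintro ⟨a, s⟩ ⟨τ, k, h⟩
  refine ⟨(a, k), Prod.ext rfl ?_⟩
  have h1 := congrArg (cross (f a)) h
  simp only [point, cross_add, cross_real_mul, cross_self_eq_zero] at h1
  simp only
  have := a.width_pos.ne'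
  rw [div_eq_iff (hf a), ← h1]
  field_simp
  ring

theorem exists_flight {z u : ℂ} {δ : ℝ} (hδ : 0 < δ)
    (h : ∀ t ∈ Ioo 0 δ, z + t * u ∈ interior P.table) (hT : P.Transverse u) :
    ∃ τ : ℝ, 0 < τ ∧ (∀ t ∈ Ioo 0 τ, z + t * u ∈ interior P.table) ∧
      ((∃ k, z + τ * u = P.vertex k) ∨ ∃ j, z + τ * u ∈ P.openSide j ∧ P.inward j u < 0) := by
  have hm := h (δ / 2) ⟨by linarith, by linarith⟩
  have hin : ∀ τ : ℝ, (∀ t ∈ Ico 0 τ, z + (δ / 2 : ℝ) * u + t * u ∈ interior P.table) →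
      ∀ t ∈ Ioo 0 (δ / 2 + τ), z + t * u ∈ interior P.table := by
    intro τ hτ t ht
    rcases lt_or_ge t (δ / 2) with h1 | h1
    · exact h t ⟨ht.1, by linarith⟩
    · convert hτ (t - δ / 2) ⟨by linarith, by linarith [ht.2]⟩ using 1
      push_cast; ring
  rcases P.exists_exitsAt_or_vertex hm hT with ⟨τ, j, hτ, hi, hj, hn⟩ | ⟨τ, k, hτ, hi, hk⟩
  · refine ⟨δ / 2 + τ, by linarith, hin τ hi, .inr ⟨j, ?_, hn⟩⟩
    convert hj using 1
    push_cast; ring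
  · refine ⟨δ / 2 + τ, by linarith, hin τ hi, .inl ⟨k, ?_⟩⟩
    rw [← hk]
    push_cast; ring

theorem exists_flight_of_inward {z u : ℂ} {i : ZMod P.n} (hz : z ∈ P.openSide i)
    (hu : 0 < P.inward i u) (hT : P.Transverse u) :
    ∃ τ : ℝ, 0 < τ ∧ (∀ t ∈ Ioo 0 τ, z + t * u ∈ interior P.table) ∧
      ((∃ k, z + τ * u = P.vertex k) ∨ ∃ j, z + τ * u ∈ P.openSide j ∧ P.inward j u < 0) := by
  obtain ⟨δ, hδ, h⟩ := P.eventually_move_mem_interior_iff hz u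
  exact exists_flight hδ (fun t ht => (h t ht).mpr hu) hT

end DirectionSet

end PolygonalBilliard

/-! ### No connections and no periodic orbits in generic directions -/

namespace PolygonalBilliard

/-- The coefficient is a product of the numbers `d / conj d` for side vectors `d` and of their
conjugates. The root-of-unity clause later makes the set of directions finite. -/
theorem linWord_eq (P : PolygonalBilliard) (L : List (ZMod P.n)) :
    ∃ a : ℂ, a * starRingEnd ℂ a = 1 ∧
      (∀ N : ℕ, (∀ i, (P.sideVec i / starRingEnd ℂ (P.sideVec i)) ^ N = 1) → a ^ N = 1) ∧
      ((∀ w, P.linWord L w = a * w) ∨ ∀ w, P.linWord L w = a * starRingEnd ℂ w) := by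
  induction L with
  | nil => exact ⟨1, by simp, by simp, .inl fun w => by simp [linWord]⟩
  | cons i L ih =>
    obtain ⟨a, ha, haN, h⟩ := ih
    have h1 := P.sideVec_ne_zero i
    have h2 := P.conj_sideVec_ne_zero i
    refine ⟨P.sideVec i / starRingEnd ℂ (P.sideVec i) * starRingEnd ℂ a, ?_, fun N hN => ?_, ?_⟩
    · simp only [map_mul, map_div₀, Complex.conj_conj]
      field_simp
      rw [mul_comm, ha]
    · rw [mul_pow, hN i, ← map_pow, haN N hN, map_one, one_mul]
    · rcases h with h | h
      · exact .inr fun w => by rw [linWord, h, lin, map_mul]; ring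
      · exact .inl fun w => by rw [linWord, h, lin, map_mul, Complex.conj_conj]; ring

/-- A rotation that fixes a nonzero vector is the identity, and a reflection is an involution. -/
theorem linWord_involutive_of_fixed (P : PolygonalBilliard) {L : List (ZMod P.n)} {u : ℂ}
    (hu : u ≠ 0) (h : P.linWord L u = u) (w : ℂ) : P.linWord L (P.linWord L w) = w := by
  obtain ⟨a, ha, -, h' | h'⟩ := P.linWord_eq L
  · rw [h'] at h
    have : a = 1 := mul_right_cancel₀ hu (by rw [h, one_mul])
    simp [h', this]
  · rw [h', h', map_mul, Complex.conj_conj, ← mul_assoc, ha, one_mul]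

namespace DirectionSet

variable {P : PolygonalBilliard} {D : P.DirectionSet}

theorem exists_bounce_or_vertex {x : D.Label × ℝ} (hx : x.2 ∈ Ioo 0 x.1.width) :
    (∃ y, Bounce x y) ∨ ∃ (τ : ℝ) (k : ZMod P.n), 0 < τ ∧ point x + τ * x.1.dir = P.vertex k := by
  obtain ⟨τ, hτ, hi, ⟨k, hk⟩ | ⟨j, hj, hn⟩⟩ :=
    exists_flight_of_inward (point_mem hx) x.1.width_pos x.1.generic.transverse
  · exact .inr ⟨τ, k, hτ, hk⟩
  · refine .inl ?_
    let b : D.Label := ⟨(j, P.lin j x.1.dir), D.lin_mem _ x.1.dir_mem j, by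
      simp only [P.inward_lin]; linarith⟩
    obtain ⟨t, ht, hp⟩ := exists_point b hj
    exact ⟨(b, t), hx, ht, rfl, τ, hτ, hp, hi⟩

/-- The orbit arrives at the side in the direction `P.lin x.1.side x.1.dir`; the flight is followed
backwards. -/
theorem exists_bounce_or_vertex_backward {x : D.Label × ℝ} (hx : x.2 ∈ Ioo 0 x.1.width) :
    (∃ y, Bounce y x) ∨ ∃ (τ : ℝ) (k : ZMod P.n), 0 < τ ∧
      point x + τ * (-P.lin x.1.side x.1.dir) = P.vertex k := by
  have hmem := D.lin_mem _ x.1.dir_mem x.1.side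
  obtain ⟨τ, hτ, hi, ⟨k, hk⟩ | ⟨j, hj, hn⟩⟩ :=
    exists_flight_of_inward (u := -P.lin x.1.side x.1.dir) (point_mem hx)
      (by rw [P.inward_neg, P.inward_lin, neg_neg]; exact x.1.width_pos)
      (D.generic _ hmem).neg.transverse
  · exact .inr ⟨τ, k, hτ, hk⟩
  · refine .inl ?_
    let b : D.Label := ⟨(j, P.lin x.1.side x.1.dir), hmem, by
      rw [P.inward_neg] at hn; simp only; linarith⟩
    have hbd : b.dir = P.lin x.1.side x.1.dir := rfl
    obtain ⟨t, ht, hp⟩ := exists_point b hj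
    refine ⟨(b, t), ht, hx, by simp only [hbd, P.lin_lin], τ, hτ, ?_, fun r hr => ?_⟩
    · rw [hp, hbd]; ring
    · convert hi (τ - r) ⟨by linarith [hr.2], by linarith [hr.1]⟩ using 1
      rw [hp, hbd]; push_cast; ring

/-- Unfolding: with the reflections undone, the broken orbit is a straight segment of length
proportional to `t`. -/
theorem exists_word_of_transGen {x y : D.Label × ℝ} (h : Relation.TransGen Bounce x y) :
    ∃ (L : List (ZMod P.n)) (t : ℝ), 0 < t ∧ point y = P.word L (point x + t * x.1.dir) ∧
      y.1.dir = P.linWord L x.1.dir := by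
  have single : ∀ {x y : D.Label × ℝ}, Bounce x y → ∃ t : ℝ, 0 < t ∧
      point y = P.refl y.1.side (point x + t * x.1.dir) := by
    rintro x y ⟨-, hy, -, τ, hτ, hp, -⟩
    -- A collision point is fixed by the reflection in its side, so the reflection may be applied to
    -- the position as well.
    exact ⟨τ, hτ, by rw [← hp, P.refl_of_mem_openSide (point_mem hy)]⟩
  induction h with
  | single h =>
    obtain ⟨t, ht, hp⟩ := single h
    exact ⟨[_], t, ht, hp, h.2.2.1⟩
  | @tail y z _ h ih =>
    obtain ⟨L, t, ht, hp, hd⟩ := ih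
    obtain ⟨τ, hτ, hp'⟩ := single h
    refine ⟨z.1.side :: L, t + τ, by linarith, ?_, ?_⟩
    · rw [hp', hp, hd, ← P.word_add_real_mul, word]
      congr 2
      push_cast; ring
    · rw [h.2.2.1, hd, linWord]

/-- The isometry that closes up a periodic orbit may be a glide reflection, so it is applied twice.
The result is the translation by `-2 * t * u`, which moves a corner along `u`, against genericity.
-/
theorem not_transGen_self (x : D.Label × ℝ) : ¬ Relation.TransGen Bounce x x := by
  intro h
  obtain ⟨L, t, ht, hp, hd⟩ := exists_word_of_transGen h
  have hg := x.1.generic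
  have hlin := P.linWord_involutive_of_fixed hg.1 hd.symm
  have h1 : P.word L (point x) = point x - t * x.1.dir := by
    rw [P.word_add_real_mul, ← hd] at hp
    linear_combination -hp
  have h2 : P.word (L ++ L) (P.vertex 0) - P.word [] (P.vertex 0) = ((-2 * t : ℝ) : ℂ) * x.1.dir := by
    have h3 : P.vertex 0 = (point x + t * x.1.dir) + (P.vertex 0 - (point x + t * x.1.dir)) := by
      ring
    rw [word_append, h3, P.word_add, ← hp, P.word_add, hlin, h1, word]
    push_cast; ring
  have := hg.2 _ _ _ _ _ h2
  linarith

/-- The billiard map as a locally isometric map of intervals. -/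
noncomputable def bounceMap (D : P.DirectionSet) : IntervalMap D.Label where
  width a := a.width
  Step := Bounce
  sgn a b := -(P.inSign a.side * P.inSign b.side)
  mem_left h := h.1
  mem_right h := h.2.1
  right_unique h h' := h.right_unique h'
  left_unique h h' := h.left_unique h'
  sgn_eq a b := by
    rcases P.inSign_eq a.side with h | h <;> rcases P.inSign_eq b.side with h' | h' <;>
      rw [h, h'] <;> norm_num
  isometry h := h.eventually
  finite_out := by
    refine (finite_vertex_hits (D := D) (fun a => a.dir) fun a => ?_).subset ?_
    · rw [cross_dir_sideVec]
      have := a.width_pos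
      rcases P.inSign_eq a.side with h | h <;> rw [h] <;> simp [this.ne']
    · rintro x ⟨hx, hno⟩
      rcases exists_bounce_or_vertex hx with ⟨y, hy⟩ | ⟨τ, k, -, h⟩
      · exact (hno y hy).elim
      · exact ⟨τ, k, h⟩
  finite_in := by
    refine (finite_vertex_hits (D := D) (fun a => -P.lin a.side a.dir) fun a => ?_).subset ?_
    · rw [cross_comm, cross_neg, neg_neg, cross_comm, cross_lin_dir_sideVec]
      have := a.width_pos
      rcases P.inSign_eq a.side with h | h <;> rw [h] <;> simp [this.ne']
    · rintro x ⟨hx, hno⟩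
      rcases exists_bounce_or_vertex_backward hx with ⟨y, hy⟩ | ⟨τ, k, -, h⟩
      · exact (hno y hy).elim
      · exact ⟨τ, k, h⟩
  no_connection := by
    intro x y hx hno hxy
    have hy : y.2 ∈ Ioo 0 y.1.width := by
      rcases hxy.cases_tail with h | ⟨z, -, hz⟩
      · rw [h]; exact hx
      · exact hz.2.1
    obtain ⟨τ, k, hτ, hk⟩ := (exists_bounce_or_vertex_backward hx).resolve_left
      fun ⟨y, h⟩ => hno y h
    refine (exists_bounce_or_vertex hy).resolve_right ?_
    rintro ⟨τ', l, hτ', hl⟩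
    obtain ⟨L, t, ht, hp, hd⟩ : ∃ (L : List (ZMod P.n)) (t : ℝ), 0 ≤ t ∧
        point y = P.word L (point x + t * x.1.dir) ∧ y.1.dir = P.linWord L x.1.dir := by
      rcases Relation.reflTransGen_iff_eq_or_transGen.mp hxy with h | h
      · subst h
        exact ⟨[], 0, le_rfl, by simp [word], rfl⟩
      · obtain ⟨L, t, ht, h⟩ := exists_word_of_transGen h
        exact ⟨L, t, ht.le, h⟩
    rw [hp, hd, ← P.word_add_real_mul] at hl
    have h1 := congrArg (P.word L.reverse) hl
    rw [P.word_reverse_word] at h1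
    -- Reflecting the incoming ray in the side of `x` puts the image of its corner behind `x` on the
    -- outgoing line. With `h1`, two corner images then differ by `t + τ' + τ` times the direction,
    -- so this sum would vanish.
    have h2 := congrArg (P.refl x.1.side) hk
    rw [refl_add, P.refl_of_mem_openSide (point_mem hx), P.lin_real_mul, P.lin_neg, P.lin_lin] at h2
    have := x.1.generic.2 L.reverse [x.1.side] l k (t + τ' + τ) (by
      rw [← h1, word, word, ← h2]; push_cast; ring)
    linarith
  no_periodic := not_transGen_self

end DirectionSet

end PolygonalBilliard

theorem abs_cross_le (u z : ℂ) : |cross u z| ≤ ‖u‖ * ‖z‖ := by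
  rw [cross_eq_im]
  calc _ ≤ ‖starRingEnd ℂ u * z‖ := Complex.abs_im_le_norm _
    _ = _ := by rw [norm_mul, RCLike.norm_conj]

/-! ### Accumulation points of a billiard orbit -/

namespace PolygonalBilliard

namespace DirectionSet

variable {P : PolygonalBilliard} {D : P.DirectionSet}

/-- The states that are accumulation points of the orbit `x`. -/
def clusterSet (x : ℕ → D.Label × ℝ) : Set (D.Label × ℝ) :=
  {y | y.2 ∈ Ioo 0 y.1.width ∧ ∀ ε > 0, ∀ N : ℕ, ∃ n ≥ N, (x n).1 = y.1 ∧ |(x n).2 - y.2| < ε}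

/-- The bounce is a rigid bijection between neighbourhoods of `y` and `z`, so visits near one
correspond to visits near the other with the index shifted by one. -/
theorem clusterSet_invariant {x : ℕ → D.Label × ℝ} (hx : ∀ n, Bounce (x n) (x (n + 1)))
    (y z : D.Label × ℝ) (h : Bounce y z) : y ∈ clusterSet x ↔ z ∈ clusterSet x := by
  obtain ⟨a, s⟩ := y
  obtain ⟨b, t⟩ := z
  obtain ⟨δ, hδ, hloc⟩ := Metric.eventually_nhds_iff.mp h.eventually
  simp only [Real.dist_eq, sub_zero] at hloc
  set σ := -(P.inSign a.side * P.inSign b.side) with hσ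
  have hσ' : σ = 1 ∨ σ = -1 := (bounceMap D).sgn_eq a b
  have hσabs : |σ| = 1 := by rcases hσ' with h | h <;> rw [h] <;> norm_num
  have hσ2 : σ * σ = 1 := by rcases hσ' with h | h <;> rw [h] <;> norm_num
  constructor
  · rintro ⟨-, hy⟩
    refine ⟨h.2.1, fun ε hε N => ?_⟩
    obtain ⟨n, hn, hna, hns⟩ := hy (min ε δ) (lt_min hε hδ) N
    simp only at hna hns
    have h1 := hloc (y := (x n).2 - s) (lt_of_lt_of_le hns (min_le_right _ _))
    rw [add_sub_cancel, ← hna] at h1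
    have h2 := (hx n).right_unique h1
    refine ⟨n + 1, by omega, by rw [h2], ?_⟩
    rw [h2]
    simp only [add_sub_cancel_left, abs_mul, hσabs, one_mul]
    exact lt_of_lt_of_le hns (min_le_left _ _)
  · rintro ⟨-, hz⟩
    refine ⟨h.1, fun ε hε N => ?_⟩
    -- The bound `N + 1` ensures that `n` has a predecessor, itself at least `N`.
    obtain ⟨n, hn, hnb, hnt⟩ := hz (min ε δ) (lt_min hε hδ) (N + 1)
    simp only at hnb hnt
    obtain ⟨m, rfl⟩ : ∃ m, n = m + 1 := ⟨n - 1, by omega⟩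
    have h0 : |σ * ((x (m + 1)).2 - t)| < min ε δ := by rwa [abs_mul, hσabs, one_mul]
    have h1 := hloc (lt_of_lt_of_le h0 (min_le_right _ _))
    rw [← mul_assoc, hσ2, one_mul, add_sub_cancel, ← hnb] at h1
    have h2 := (hx m).left_unique h1
    refine ⟨m, by omega, by rw [h2], ?_⟩
    rw [h2]
    simp only [add_sub_cancel_left]
    exact lt_of_lt_of_le h0 (min_le_left _ _)

theorem eventually_notMem_clusterSet {x : ℕ → D.Label × ℝ} {a : D.Label} {s : ℝ}
    (hs : s ∈ Ioo 0 a.width) (h : (a, s) ∉ clusterSet x) :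
    ∀ᶠ t in nhds s, (a, t) ∉ clusterSet x := by
  simp only [clusterSet, mem_ofPred_eq, not_and, not_forall] at h
  obtain ⟨ε, hε, N, hN⟩ := h hs
  filter_upwards [Metric.ball_mem_nhds s (half_pos hε)] with t ht ⟨_, h'⟩
  obtain ⟨n, hn, hna, hnt⟩ := h' (ε / 2) (half_pos hε) N
  refine hN ⟨n, hn, hna, ?_⟩
  rw [Metric.mem_ball, Real.dist_eq] at ht
  simp only at hnt ⊢
  have := abs_sub_le (x n).2 t s
  linarith

theorem mem_clusterSet_of_label_eq {x : ℕ → D.Label × ℝ} (hx : ∀ n, Bounce (x n) (x (n + 1)))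
    {a : D.Label} {s t : ℝ} (h : (a, s) ∈ clusterSet x) (ht : t ∈ Ioo 0 a.width) :
    (a, t) ∈ clusterSet x :=
  (bounceMap D).mem_of_invariant (clusterSet_invariant hx)
    (fun _ _ hs => eventually_notMem_clusterSet hs) h.1 ht h

theorem continuous_point (a : D.Label) : Continuous fun s => point (a, s) := by
  change Continuous fun s : ℝ => P.vertex a.side + ((s / a.width : ℝ) : ℂ) * P.sideVec a.side
  fun_prop

/-- The states of one label at distance at least `η` from all corners form a compact part of the
open interval; infinitely many visits there would accumulate. -/
theorem eventually_near_vertex {x : ℕ → D.Label × ℝ} (hx : ∀ n, Bounce (x n) (x (n + 1)))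
    (hK : clusterSet x = ∅) {η : ℝ} (hη : 0 < η) :
    ∀ᶠ n in Filter.atTop, ∃ k, dist (point (x n)) (P.vertex k) < η := by
  by_contra hcon
  rw [Filter.not_eventually] at hcon
  obtain ⟨a, ha⟩ : ∃ a : D.Label, ∃ᶠ n in Filter.atTop, (x n).1 = a ∧
      ¬ ∃ k, dist (point (x n)) (P.vertex k) < η := by
    by_contra! h
    refine hcon ((Filter.eventually_all.mpr h).mono fun n hn => ?_)
    simpa using hn (x n).1
  set C : Set ℝ := Icc 0 a.width ∩ ⋂ k, {s | η ≤ dist (point (a, s)) (P.vertex k)}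
  have hC : IsCompact C := isCompact_Icc.inter_right (isClosed_iInter fun k =>
    isClosed_le continuous_const ((continuous_point a).dist continuous_const))
  obtain ⟨s, hs, hcl⟩ := hC.exists_mapClusterPt_of_frequently
    (l := Filter.atTop ⊓ Filter.principal {n | (x n).1 = a}) (f := fun n => (x n).2) (by
      rw [Filter.frequently_inf_principal]
      refine ha.mono fun n hn => ⟨hn.1, ⟨?_, ?_⟩⟩
      · have := (hx n).1
        rw [hn.1] at this
        exact ⟨this.1.le, this.2.le⟩
      · have h2 := hn.2
        simp only [not_exists, not_lt] at h2
        rw [mem_iInter]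
        intro k
        have := h2 k
        rwa [show x n = (a, (x n).2) from Prod.ext hn.1 rfl] at this)
  have hsk : ∀ k, η ≤ dist (point (a, s)) (P.vertex k) := fun k => mem_iInter.mp hs.2 k
  have hs0 : s ≠ 0 := by
    rintro rfl
    have := hsk a.side
    simp [point] at this
    linarith
  have hsW : s ≠ a.width := by
    rintro rfl
    have := hsk (a.side + 1)
    simp [point, div_self a.width_pos.ne', sideVec] at this
    linarith
  have : (a, s) ∈ clusterSet x := by
    refine ⟨⟨lt_of_le_of_ne hs.1.1 hs0.symm, lt_of_le_of_ne hs.1.2 hsW⟩, fun ε hε N => ?_⟩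
    have h1 := (mapClusterPt_iff_frequently.mp hcl) _ (Metric.ball_mem_nhds s hε)
    rw [Filter.frequently_inf_principal, Filter.frequently_atTop] at h1
    obtain ⟨n, hn, hna, hns⟩ := h1 N
    exact ⟨n, hn, hna, by rwa [Metric.mem_ball, Real.dist_eq] at hns⟩
  rw [hK] at this
  exact this

theorem exists_cross_vertex_lower_bound (D : P.DirectionSet) :
    ∃ c > 0, ∀ u ∈ D.dirs, ∀ k l, k ≠ l → c ≤ |cross u (P.vertex k - P.vertex l)| := by
  set B : Set ℝ := (fun q : ℂ × ZMod P.n × ZMod P.n => |cross q.1 (P.vertex q.2.1 - P.vertex q.2.2)|) ''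
    {q | q.1 ∈ D.dirs ∧ q.2.1 ≠ q.2.2}
  have hB : B.Finite := ((D.finite.prod Set.finite_univ).subset
    fun q hq => ⟨hq.1, mem_univ _⟩).image _
  have hpos : ∀ b ∈ B, 0 < b := by
    rintro _ ⟨⟨u, k, l⟩, ⟨hu, hkl⟩, rfl⟩
    refine abs_pos.mpr fun h => ?_
    have hg := D.generic u hu
    have h1 := exists_real_mul_of_cross_eq_zero hg.1 h
    have h2 := hg.2 [] [] k l _ h1
    simp only [h2, Complex.ofReal_zero, zero_mul, sub_eq_zero] at h1
    exact hkl (P.vertex_injective h1)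
  rcases B.eq_empty_or_nonempty with h | h
  · refine ⟨1, one_pos, fun u hu k l hkl => ?_⟩
    exact absurd (show _ ∈ B from ⟨(u, k, l), ⟨hu, hkl⟩, rfl⟩) (h ▸ notMem_empty _)
  · obtain ⟨b, hb, hmin⟩ := hB.exists_minimal h
    refine ⟨b, hpos b hb, fun u hu k l hkl => ?_⟩
    have hmem : |cross u (P.vertex k - P.vertex l)| ∈ B := ⟨(u, k, l), ⟨hu, hkl⟩, rfl⟩
    by_contra! hlt
    exact absurd (hmin hmem hlt.le) (not_le.mpr hlt)

theorem exists_dist_vertex_lower_bound (P : PolygonalBilliard) :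
    ∃ c > 0, ∀ i k, k ≠ i → k ≠ i + 1 → ∀ z ∈ P.openSide i, c ≤ dist z (P.vertex k) := by
  have h : ∀ i k, ∃ c > 0, k ≠ i → k ≠ i + 1 → ∀ z ∈ P.openSide i, c ≤ dist z (P.vertex k) := by
    intro i k
    by_cases h : k ≠ i ∧ k ≠ i + 1
    · have hk : P.vertex k ∉ closure (P.openSide i) := by
        rw [openSide, closure_openSegment]
        intro hk
        exact P.vertex_notMem_openSide i k (mem_openSegment_of_ne_left_right
          (fun h' => h.1 (P.vertex_injective h').symm)
          (fun h' => h.2 (P.vertex_injective h').symm) hk)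
      rw [Metric.mem_closure_iff] at hk
      push Not at hk
      obtain ⟨ε, hε, h'⟩ := hk
      exact ⟨ε, hε, fun _ _ z hz => by rw [dist_comm]; exact h' z hz⟩
    · exact ⟨1, one_pos, fun h1 h2 => absurd ⟨h1, h2⟩ h⟩
  choose c hc hcb using h
  obtain ⟨q, hq⟩ := Finite.exists_min fun q : ZMod P.n × ZMod P.n => c q.1 q.2
  exact ⟨c q.1 q.2, hc _ _, fun i k h1 h2 z hz => (hq (i, k)).trans (hcb i k h1 h2 z hz)⟩

theorem vertex_sub_eq_of_adjacent {i k : ZMod P.n} (hk : k = i ∨ k = i + 1) {z : ℂ}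
    (hz : z ∈ P.openSide i) : ∃ t : ℝ, t ≠ 0 ∧ z - P.vertex k = t * P.sideVec i := by
  obtain ⟨t, ht, rfl⟩ := P.mem_openSide_iff.mp hz
  rcases hk with rfl | rfl
  · exact ⟨t, ht.1.ne', by ring⟩
  · refine ⟨t - 1, by linarith [ht.2], ?_⟩
    simp only [sideVec]; push_cast; ring

/-- An orbit without accumulation points would approach the corners. A flight cannot lead from near
one corner to near another, since no two corners are aligned with its direction; so the orbit stays
near a single corner `k`, on sides adjacent to it. There the distance of the flight line from the
corner is conserved, up to a factor, yet tends to zero. So it vanishes, although the flight is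
transverse to a side through `k`. -/
theorem clusterSet_nonempty {x : ℕ → D.Label × ℝ} (hx : ∀ n, Bounce (x n) (x (n + 1))) :
    (clusterSet x).Nonempty := by
  rw [nonempty_iff_ne_empty]
  intro hK
  obtain ⟨c, hc, hcb⟩ := exists_cross_vertex_lower_bound D
  obtain ⟨e, he, heb⟩ := exists_dist_vertex_lower_bound P
  obtain ⟨M, hM⟩ := D.finite.isBounded.exists_norm_le
  have hM0 : 0 < M := lt_of_lt_of_le (norm_pos_iff.mpr (x 0).1.generic.1) (hM _ (x 0).1.dir_mem)
  have hle : ∀ u ∈ D.dirs, ∀ z, |cross u z| ≤ M * ‖z‖ := fun u hu z =>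
    (abs_cross_le u z).trans (by gcongr; exact hM u hu)
  set η := min e (c / (2 * M)) with hη
  have hη0 : 0 < η := by positivity
  -- Applying `cross u` kills `z - z'` and leaves an error below `2 * M * η ≤ c`, too small for two
  -- distinct corners.
  have huniq : ∀ u ∈ D.dirs, ∀ z z' k l, cross u (z - z') = 0 → dist z (P.vertex k) < η →
      dist z' (P.vertex l) < η → k = l := by
    intro u hu z z' k l h0 hk hl
    by_contra hkl
    have h1 := hcb u hu k l hkl
    have h2 : P.vertex k - P.vertex l = -(z - P.vertex k) + (z - z') + (z' - P.vertex l) := by ring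
    rw [h2, cross_add, cross_add, h0, add_zero, cross_neg] at h1
    have h3 := abs_add_le (-cross u (z - P.vertex k)) (cross u (z' - P.vertex l))
    rw [abs_neg] at h3
    have h4 := hle u hu (z - P.vertex k)
    have h5 := hle u hu (z' - P.vertex l)
    rw [← dist_eq_norm] at h4 h5
    have h6 : η ≤ c / (2 * M) := min_le_right _ _
    rw [le_div_iff₀ (by positivity)] at h6
    have h7 := mul_lt_mul_of_pos_left hk hM0
    have h8 := mul_lt_mul_of_pos_left hl hM0
    linarith
  have hstep : ∀ n (w : ℂ), cross (x n).1.dir (point (x (n + 1)) - w) =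
      cross (x n).1.dir (point (x n) - w) := by
    intro n w
    obtain ⟨-, -, -, τ, -, hp, -⟩ := hx n
    rw [hp, add_sub_right_comm, cross_add, cross_real_mul, cross_self_eq_zero, mul_zero, add_zero]
  obtain ⟨N, hN⟩ := Filter.eventually_atTop.mp (eventually_near_vertex hx hK hη0)
  obtain ⟨k, hk⟩ := hN N le_rfl
  have hall : ∀ m, dist (point (x (N + m))) (P.vertex k) < η := fun m => by
    induction m with
    | zero => exact hk
    | succ m ih =>
      obtain ⟨l, hl⟩ := hN (N + m + 1) (by omega)
      have h0 := hstep (N + m) (point (x (N + m)))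
      rw [sub_self] at h0
      have := huniq _ (x (N + m)).1.dir_mem _ _ l k (by rw [h0]; simp [cross]) hl ih
      rw [this] at hl
      exact hl
  have hadj : ∀ m, k = (x (N + m)).1.side ∨ k = (x (N + m)).1.side + 1 := by
    intro m
    by_contra! h
    have := heb _ k h.1 h.2 _ (point_mem (hx (N + m)).1)
    linarith [hall m, min_le_left e (c / (2 * M))]
  -- A flight does not change the cross product with its own direction, and a reflection in a side
  -- through the corner changes at most its sign.
  have hconst : ∀ m, |cross (x (N + m)).1.dir (point (x (N + m)) - P.vertex k)| =
      |cross (x N).1.dir (point (x N) - P.vertex k)| := fun m => by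
    induction m with
    | zero => rfl
    | succ m ih =>
      rw [← ih, ← hstep (N + m)]
      obtain ⟨t, -, ht⟩ := vertex_sub_eq_of_adjacent (hadj (m + 1)) (point_mem (hx (N + (m + 1))).1)
      rw [← add_assoc] at ht ⊢
      have h1 := (hx (N + m)).2.2.1
      have h2 := P.abs_cross_lin (x (N + m + 1)).1.side (x (N + m)).1.dir
        (point (x (N + m + 1)) - P.vertex k)
      rw [h1, ← h2]
      congr 2
      rw [ht, P.lin_real_mul, P.lin_sideVec]
  have hzero : |cross (x N).1.dir (point (x N) - P.vertex k)| = 0 := by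
    refine le_antisymm (le_of_forall_pos_le_add fun ε hε => ?_) (abs_nonneg _)
    have hε' : 0 < min η (ε / M) := lt_min hη0 (by positivity)
    obtain ⟨N', hN'⟩ := Filter.eventually_atTop.mp (eventually_near_vertex hx hK hε')
    obtain ⟨l, hl⟩ := hN' (N + N') (by omega)
    have := huniq _ (x N).1.dir_mem _ _ l k (by simp [cross])
      (lt_of_lt_of_le hl (min_le_left _ _)) (hall N')
    subst this
    have h1 := hle _ (x (N + N')).1.dir_mem (point (x (N + N')) - P.vertex l)
    rw [hconst, ← dist_eq_norm] at h1
    have h2 := lt_of_lt_of_le hl (min_le_right _ _)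
    rw [lt_div_iff₀ hM0] at h2
    linarith
  obtain ⟨t, ht, h⟩ := vertex_sub_eq_of_adjacent (hadj 0) (point_mem (hx N).1)
  rw [abs_eq_zero] at hzero
  simp only [add_zero] at h
  rw [h, cross_real_mul, cross_dir_sideVec] at hzero
  have := (x N).1.width_pos
  rcases P.inSign_eq (x N).1.side with h | h <;> rw [h] at hzero <;> simp [ht, this.ne'] at hzero

end DirectionSet

end PolygonalBilliard

/-! ### Density of orbits by connectedness of the table -/

namespace PolygonalBilliard

namespace DirectionSet

variable {P : PolygonalBilliard} {D : P.DirectionSet}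

/-- The straight line through `m` in the direction `u` starts in the state `y`, or the state `y`
is the state in which the orbit leaves the end of this line. -/
def OnFlight (m u : ℂ) (y : D.Label × ℝ) : Prop :=
  y.2 ∈ Ioo 0 y.1.width ∧
    ((y.1.dir = u ∧ ∃ τ : ℝ, P.ExitsAt m (-u) τ y.1.side ∧ point y = m + τ * (-u)) ∨
      (y.1.dir = P.lin y.1.side u ∧ ∃ τ : ℝ, P.ExitsAt m u τ y.1.side ∧ point y = m + τ * u))

theorem exitsAt_unique {m u : ℂ} {τ τ' : ℝ} {i j : ZMod P.n} (h : P.ExitsAt m u τ i)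
    (h' : P.ExitsAt m u τ' j) : τ = τ' ∧ i = j := by
  have := P.exit_time_unique h.1 h'.1 (fun t ht => h.2.1 t ⟨ht.1.le, ht.2⟩)
    (fun t ht => h'.2.1 t ⟨ht.1.le, ht.2⟩) (P.openSide_subset_frontier _ h.2.2.1)
    (P.openSide_subset_frontier _ h'.2.2.1)
  subst this
  exact ⟨rfl, P.openSide_unique h.2.2.1 h'.2.2.1⟩

/-- Two states of the same flight are equal or joined by one bounce. -/
theorem OnFlight.mem_iff {K : Set (D.Label × ℝ)} (hK : ∀ y z, Bounce y z → (y ∈ K ↔ z ∈ K))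
    {m u : ℂ} {y z : D.Label × ℝ} (hy : OnFlight m u y) (hz : OnFlight m u z) :
    y ∈ K ↔ z ∈ K := by
  obtain ⟨hy, ⟨hyd, τ, hye, hyp⟩ | ⟨hyd, τ, hye, hyp⟩⟩ := hy <;>
    obtain ⟨hz, ⟨hzd, τ', hze, hzp⟩ | ⟨hzd, τ', hze, hzp⟩⟩ := hz
  · obtain ⟨h, -⟩ := exitsAt_unique hye hze
    rw [state_ext hy hz (hyd.trans hzd.symm) (by rw [hyp, hzp, h])]
  · subst hyd
    exact hK _ _ (bounce_of_exitsAt hy hz hzd hze hye hzp hyp)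
  · subst hzd
    exact (hK _ _ (bounce_of_exitsAt hz hy hyd hye hze hyp hzp)).symm
  · obtain ⟨h, h'⟩ := exitsAt_unique hye hze
    rw [state_ext hy hz (by rw [hyd, hzd, h']) (by rw [hyp, hzp, h])]

/-- Nearby flights end on the same side, hence in the same label, and membership in `K` depends on
the label only. -/
theorem isOpen_setOf_onFlight {K : Set (D.Label × ℝ)}
    (hK : ∀ (a : D.Label) s t, (a, s) ∈ K → s ∈ Ioo 0 a.width → t ∈ Ioo 0 a.width → (a, t) ∈ K)
    (u : ℂ) : IsOpen {m | ∃ y ∈ K, OnFlight m u y} := by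
  rw [isOpen_iff_eventually]
  rintro m ⟨⟨a, s⟩, hyK, hy, h⟩
  rcases h with ⟨hd, τ, he, -⟩ | ⟨hd, τ, he, -⟩
  all_goals
    filter_upwards [he.eventually] with m' ⟨τ', he'⟩
    obtain ⟨t, ht, hp⟩ := exists_point a he'.2.2.1
    refine ⟨(a, t), hK a s t hyK hy ht, ht, ?_⟩
  · exact .inl ⟨hd, τ', he', hp⟩
  · exact .inr ⟨hd, τ', he', hp⟩

/-- A flight with corners at both ends would join two corners along `u`, so at least one end lies on
an open side. -/
theorem exists_onFlight {m u : ℂ} (hu : u ∈ D.dirs) (hm : m ∈ interior P.table) :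
    ∃ y : D.Label × ℝ, OnFlight m u y := by
  have hg := D.generic u hu
  rcases P.exists_exitsAt_or_vertex hm hg.neg.transverse with ⟨τ, i, h⟩ | ⟨τ, k, hτ, -, hk⟩
  · let a : D.Label := ⟨(i, u), hu, by
      have := h.2.2.2
      rw [P.inward_neg] at this
      simp only; linarith⟩
    obtain ⟨s, hs, hp⟩ := exists_point a h.2.2.1
    exact ⟨(a, s), hs, .inl ⟨rfl, τ, h, hp⟩⟩
  rcases P.exists_exitsAt_or_vertex hm hg.transverse with ⟨τ', j, h⟩ | ⟨τ', l, hτ', -, hl⟩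
  · let a : D.Label := ⟨(j, P.lin j u), D.lin_mem u hu j, by
      have := h.2.2.2
      simp only [P.inward_lin]; linarith⟩
    obtain ⟨s, hs, hp⟩ := exists_point a h.2.2.1
    exact ⟨(a, s), hs, .inr ⟨rfl, τ', h, hp⟩⟩
  · have := hg.2 [] [] l k (τ + τ') (by
      simp only [word]
      rw [← hl, ← hk]; push_cast; ring)
    linarith

/-- Every infinite billiard orbit in generic directions visits every neighbourhood, relative to
the boundary, of every boundary point that is not a corner. -/
theorem exists_point_mem {x : ℕ → D.Label × ℝ} (hx : ∀ n, Bounce (x n) (x (n + 1)))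
    {i : ZMod P.n} {z : ℂ} (hz : z ∈ P.openSide i) {A : Set ℂ}
    (hA : ∀ᶠ w in nhds z, w ∈ P.openSide i → w ∈ A) : ∃ n, point (x n) ∈ A := by
  set K := clusterSet x
  have hinv := clusterSet_invariant hx
  have hKu : ∀ (a : D.Label) s t, (a, s) ∈ K → t ∈ Ioo 0 a.width → (a, t) ∈ K :=
    fun a s t hs ht => mem_clusterSet_of_label_eq hx hs ht
  obtain ⟨y₀, hy₀⟩ := clusterSet_nonempty hx
  set u := y₀.1.dir
  have hu : u ∈ D.dirs := y₀.1.dir_mem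
  have hT := (D.generic u hu).transverse
  -- `U` and `V` are the unions of the flights in the direction `u` that belong to `K` and to its
  -- complement. They split the connected interior into disjoint open sets, and `U` is not empty.
  set U : Set ℂ := {m | ∃ y ∈ K, OnFlight m u y}
  set V : Set ℂ := {m | ∃ y ∈ Kᶜ, OnFlight m u y}
  have hU : IsOpen U := isOpen_setOf_onFlight (fun a s t h _ ht => hKu a s t h ht) u
  have hV : IsOpen V := isOpen_setOf_onFlight (K := Kᶜ)
    (fun a s t (h : (a, s) ∉ K) hs _ ht => h (hKu a t s ht hs)) u
  have hdisj : Disjoint U V := Set.disjoint_left.mpr fun m ⟨y, hy, hmy⟩ ⟨z, hz, hmz⟩ =>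
    hz ((hmy.mem_iff hinv hmz).mp hy)
  have hcov : interior P.table ⊆ U ∪ V := fun m hm => by
    obtain ⟨y, hy⟩ := exists_onFlight hu hm
    by_cases h : y ∈ K
    · exact .inl ⟨y, h, hy⟩
    · exact .inr ⟨y, h, hy⟩
  -- a boundary point is the end point of a short piece of a line inside the table
  have hshort : ∀ {i} {z v : ℂ}, z ∈ P.openSide i → P.Transverse v → 0 < P.inward i v →
      ∃ m ∈ interior P.table, ∃ τ : ℝ, P.ExitsAt m (-v) τ i ∧ z = m + τ * (-v) := by
    intro i z v hz hv hpos
    obtain ⟨δ, hδ, h⟩ := P.eventually_move_mem_interior_iff hz v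
    have h0 : z + (δ / 2 : ℝ) * v + (δ / 2 : ℝ) * (-v) = z := by ring
    refine ⟨z + (δ / 2 : ℝ) * v, (h _ ⟨by linarith, by linarith⟩).mpr hpos, δ / 2,
      P.exitsAt_of_mem_openSide hv.neg (by linarith) (fun t ht => ?_) (by rwa [h0]), h0.symm⟩
    convert (h (δ / 2 - t) ⟨by linarith [ht.2], by linarith [ht.1]⟩).mpr hpos using 1
    push_cast; ring
  have hsub : interior P.table ⊆ U := by
    refine P.isConnected_interior_table.isPreconnected.subset_left_of_subset_union hU hV hdisj
      hcov ?_
    obtain ⟨m, hm, τ, he, hp⟩ := hshort (point_mem hy₀.1) hT y₀.1.width_pos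
    exact ⟨m, hm, y₀, hy₀, hy₀.1, .inl ⟨rfl, τ, he, hp⟩⟩
  obtain ⟨a, s, hai, hs, hp, haK⟩ : ∃ (a : D.Label) (s : ℝ), a.side = i ∧ s ∈ Ioo 0 a.width ∧
      point (a, s) = z ∧ (a, s) ∈ K := by
    -- At the side `i` either flights in the direction `u` end, and the reflected state is used, or
    -- they start there.
    rcases lt_or_gt_of_ne (hT i) with hneg | hpos
    · obtain ⟨m, hm, τ, he, hp⟩ := hshort hz hT.neg (by rw [P.inward_neg]; linarith)
      rw [neg_neg] at he hp
      let a : D.Label := ⟨(i, P.lin i u), D.lin_mem u hu i, by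
        simp only [P.inward_lin]; linarith⟩
      obtain ⟨s, hs, hps⟩ := exists_point a hz
      obtain ⟨y, hyK, hy⟩ := hsub hm
      exact ⟨a, s, rfl, hs, hps, (hy.mem_iff hinv
        (⟨hs, .inr ⟨rfl, τ, he, hps.trans hp⟩⟩ : OnFlight m u (a, s))).mp hyK⟩
    · obtain ⟨m, hm, τ, he, hp⟩ := hshort hz hT hpos
      let a : D.Label := ⟨(i, u), hu, hpos⟩
      obtain ⟨s, hs, hps⟩ := exists_point a hz
      obtain ⟨y, hyK, hy⟩ := hsub hm
      exact ⟨a, s, rfl, hs, hps, (hy.mem_iff hinv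
        (⟨hs, .inl ⟨rfl, τ, he, hps.trans hp⟩⟩ : OnFlight m u (a, s))).mp hyK⟩
  have htend : Filter.Tendsto (fun t => point (a, t)) (nhds s) (nhds z) := by
    rw [← hp]; exact (continuous_point a).tendsto s
  obtain ⟨ε, hε, hball⟩ := Metric.eventually_nhds_iff.mp (htend.eventually hA)
  obtain ⟨n, -, hna, hns⟩ := haK.2 ε hε 0
  have hxn : x n = (a, (x n).2) := Prod.ext hna rfl
  refine ⟨n, ?_⟩
  rw [hxn]
  refine hball (by rwa [Real.dist_eq]) ?_
  have := point_mem (hx n).1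
  rwa [show (x n).1 = a from hna, hai, hxn] at this

end DirectionSet

end PolygonalBilliard

/-! ### Finitely many directions, almost all of them generic -/

namespace PolygonalBilliard

variable (P : PolygonalBilliard)

/-- The unit complex number whose argument is twice that of the `i`-th side. -/
noncomputable def turn (i : ZMod P.n) : ℂ := P.sideVec i / starRingEnd ℂ (P.sideVec i)

theorem turn_ne_zero (i : ZMod P.n) : P.turn i ≠ 0 :=
  div_ne_zero (P.sideVec_ne_zero i) (P.conj_sideVec_ne_zero i)

theorem exists_pow_div_conj_eq_one {z : ℂ} (hz : z ≠ 0) {q : ℚ} (h : |z.arg| = q * Real.pi) :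
    ∃ N : ℕ, 0 < N ∧ (z / starRingEnd ℂ z) ^ N = 1 := by
  obtain ⟨r, hr⟩ : ∃ r : ℚ, z.arg = r * Real.pi := by
    rcases abs_cases z.arg with h' | h'
    · exact ⟨q, by linarith⟩
    · exact ⟨-q, by push_cast; linarith⟩
  have hn : (‖z‖ : ℂ) ≠ 0 := by simpa using hz
  have h1 : z / starRingEnd ℂ z = Complex.exp (2 * z.arg * Complex.I) := by
    conv_lhs => rw [← Complex.norm_mul_exp_arg_mul_I z]
    rw [map_mul, Complex.conj_ofReal, ← Complex.exp_conj, map_mul, Complex.conj_I,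
      Complex.conj_ofReal, mul_div_mul_left _ _ hn, ← Complex.exp_sub]
    congr 1; ring
  refine ⟨r.den, r.den_pos, ?_⟩
  rw [h1, ← Complex.exp_nat_mul, Complex.exp_eq_one_iff]
  refine ⟨r.num, ?_⟩
  rw [hr]
  have h2 : (r : ℂ) * r.den = r.num := by exact_mod_cast Rat.mul_den_eq_num r
  push_cast
  linear_combination 2 * Real.pi * Complex.I * h2

/-- Both cases of `interiorAngle` make the unoriented angle rational. Its sign and the reversal of
one side vector disappear in `z / conj z`. -/
theorem exists_pow_turn_div_eq_one (hP : P.IsRational) (i : ZMod P.n) :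
    ∃ N : ℕ, 0 < N ∧ (P.turn (i - 1) / P.turn i) ^ N = 1 := by
  obtain ⟨q, hq⟩ : ∃ q : ℚ,
      EuclideanGeometry.angle (P.vertex (i - 1)) (P.vertex i) (P.vertex (i + 1)) = q * Real.pi := by
    obtain ⟨q, hq⟩ := hP i
    unfold interiorAngle at hq
    split_ifs at hq
    · exact ⟨q, hq⟩
    · exact ⟨2 - q, by push_cast; linarith⟩
  have h1 : P.vertex (i - 1) -ᵥ P.vertex i = -P.sideVec (i - 1) := by
    rw [sideVec, sub_add_cancel, neg_sub]; rfl
  have h2 : P.vertex (i + 1) -ᵥ P.vertex i = P.sideVec i := rfl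
  have hne := P.sideVec_ne_zero i
  have hne' := P.sideVec_ne_zero (i - 1)
  rw [EuclideanGeometry.angle, h1, h2, Complex.angle_eq_abs_arg (neg_ne_zero.mpr hne') hne] at hq
  obtain ⟨N, hN, h⟩ := exists_pow_div_conj_eq_one (div_ne_zero (neg_ne_zero.mpr hne') hne) hq
  refine ⟨N, hN, ?_⟩
  rw [← h]
  congr 1
  have := P.conj_sideVec_ne_zero i
  have := P.conj_sideVec_ne_zero (i - 1)
  simp only [turn, map_div₀, map_neg]
  field_simp

/-- Rational angles only control quotients of neighbouring turns. The vertical side `i₀` supplies a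
start, with turn `-1`, and the rest follows around the polygon. -/
theorem exists_pow_turn_eq_one (hP : P.IsRational) {i₀ : ZMod P.n}
    (h₀ : (P.sideVec i₀).re = 0) : ∃ N : ℕ, 0 < N ∧ ∀ i, P.turn i ^ N = 1 := by
  have hall : ∀ k : ℕ, ∃ N : ℕ, 0 < N ∧ P.turn (i₀ + k) ^ N = 1 := fun k => by
    induction k with
    | zero =>
      have h1 : starRingEnd ℂ (P.sideVec i₀) = -P.sideVec i₀ := by
        apply Complex.ext <;> simp [h₀]
      refine ⟨2, two_pos, ?_⟩
      rw [Nat.cast_zero, add_zero, turn, h1, div_neg, div_self (P.sideVec_ne_zero i₀)]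
      norm_num
    | succ k ih =>
      obtain ⟨N, hN, h⟩ := ih
      obtain ⟨M, hM, h'⟩ := P.exists_pow_turn_div_eq_one hP (i₀ + (k + 1 : ℕ))
      refine ⟨N * M, by positivity, ?_⟩
      have h1 : i₀ + (k + 1 : ℕ) - 1 = i₀ + k := by push_cast; ring
      rw [h1, div_pow, div_eq_one_iff_eq (pow_ne_zero _ (P.turn_ne_zero _))] at h'
      rw [mul_comm, pow_mul, ← h', ← pow_mul, mul_comm, pow_mul, h, one_pow]
  have hall' : ∀ i, ∃ N : ℕ, 0 < N ∧ P.turn i ^ N = 1 := fun i => by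
    obtain ⟨N, hN, h⟩ := hall (i - i₀).val
    rw [ZMod.natCast_zmod_val, add_sub_cancel] at h
    exact ⟨N, hN, h⟩
  choose N hN h using hall'
  refine ⟨∏ i, N i, Finset.prod_pos fun i _ => hN i, fun i => ?_⟩
  obtain ⟨c, hc⟩ := Finset.dvd_prod_of_mem N (Finset.mem_univ i)
  rw [hc, pow_mul, h, one_pow]

/-- The directions `± linWord L u`. -/
def directions (u : ℂ) : Set ℂ := {w | ∃ L, w = P.linWord L u ∨ w = -P.linWord L u}

theorem lin_mem_directions {u w : ℂ} (h : w ∈ P.directions u) (i : ZMod P.n) :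
    P.lin i w ∈ P.directions u := by
  obtain ⟨L, rfl | rfl⟩ := h
  · exact ⟨i :: L, .inl rfl⟩
  · exact ⟨i :: L, .inr (P.lin_neg _ _)⟩

/-- Opposite directions are included because both the Andreev reflection and time reversal negate
the folded direction. -/
theorem neg_mem_directions {u w : ℂ} (h : w ∈ P.directions u) : -w ∈ P.directions u := by
  obtain ⟨L, rfl | rfl⟩ := h
  · exact ⟨L, .inr rfl⟩
  · exact ⟨L, .inl (neg_neg _)⟩

theorem finite_directions {N : ℕ} (hN : 0 < N) (h : ∀ i, P.turn i ^ N = 1) (u : ℂ) :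
    (P.directions u).Finite := by
  have hfin : {a : ℂ | a ^ N = 1}.Finite := by
    refine (Polynomial.nthRoots N (1 : ℂ)).toFinset.finite_toSet.subset fun a ha => ?_
    simpa [Polynomial.mem_nthRoots hN] using ha
  have : Finite {a : ℂ | a ^ N = 1} := hfin.to_subtype
  refine ((((hfin.image (· * u)).union (hfin.image (· * starRingEnd ℂ u))).union
    ((hfin.image (-· * u)).union (hfin.image (-· * starRingEnd ℂ u))))).subset ?_
  rintro w ⟨L, hw⟩
  obtain ⟨a, -, ha, h' | h'⟩ := P.linWord_eq L <;> rw [h'] at hw <;> rcases hw with rfl | rfl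
  · exact .inl (.inl ⟨a, ha N h, rfl⟩)
  · exact .inr (.inl ⟨a, ha N h, by simp⟩)
  · exact .inl (.inr ⟨a, ha N h, rfl⟩)
  · exact .inr (.inr ⟨a, ha N h, by simp⟩)

/-- The set of directions that arise from a generic one. -/
def directionSet {N : ℕ} (hN : 0 < N) (h : ∀ i, P.turn i ^ N = 1) {u : ℂ} (hu : P.Generic u) :
    P.DirectionSet where
  dirs := P.directions u
  finite := P.finite_directions hN h u
  generic := by
    rintro w ⟨L, rfl | rfl⟩
    · exact hu.linWord L
    · exact (hu.linWord L).neg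
  lin_mem _ hw i := P.lin_mem_directions hw i

/-- There are countably many differences of corner images, and each nonzero one is parallel to only
countably many `θ`. -/
theorem ae_generic : ∀ᵐ θ : ℝ, P.Generic (Real.Angle.toCircle (θ : Real.Angle)) := by
  have key : ∀ d : ℂ, d ≠ 0 → ∀ᵐ θ : ℝ, ∀ t : ℝ, d ≠ t * (Real.Angle.toCircle (θ : Real.Angle) : ℂ) := by
    intro d hd
    have hc : (Set.range fun k : ℤ => d.arg - k * Real.pi).Countable := Set.countable_range _
    filter_upwards [(hc.ae_notMem volume)] with θ hθ t ht
    apply hθ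
    have h1 : cross (Real.Angle.toCircle (θ : Real.Angle)) d = 0 := by
      rw [ht, cross_real_mul, cross_self_eq_zero, mul_zero]
    have h2 : cross (Real.Angle.toCircle (θ : Real.Angle)) d = ‖d‖ * Real.sin (d.arg - θ) := by
      rw [Real.sin_sub, mul_sub, ← mul_assoc, ← mul_assoc, Complex.norm_mul_sin_arg,
        Complex.norm_mul_cos_arg]
      simp [cross]
      ring
    rw [h2, mul_eq_zero, or_iff_right (norm_ne_zero_iff.mpr hd), Real.sin_eq_zero_iff] at h1
    obtain ⟨k, hk⟩ := h1
    exact ⟨k, by simp only [hk]; ring⟩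
  have hall : ∀ᵐ θ : ℝ, ∀ q : List (ZMod P.n) × List (ZMod P.n) × ZMod P.n × ZMod P.n,
      P.word q.1 (P.vertex q.2.2.1) - P.word q.2.1 (P.vertex q.2.2.2) ≠ 0 → ∀ t : ℝ,
      P.word q.1 (P.vertex q.2.2.1) - P.word q.2.1 (P.vertex q.2.2.2) ≠
        t * (Real.Angle.toCircle (θ : Real.Angle) : ℂ) := by
    rw [ae_all_iff]
    intro q
    by_cases h : P.word q.1 (P.vertex q.2.2.1) - P.word q.2.1 (P.vertex q.2.2.2) = 0
    · exact Filter.Eventually.of_forall fun θ h' => absurd h h'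
    · filter_upwards [key _ h] with θ hθ _
      exact hθ
  filter_upwards [hall] with θ hθ
  refine ⟨Circle.coe_ne_zero _, fun L L' k l t ht => ?_⟩
  by_contra htne
  refine hθ (L, L', k, l) ?_ t ht
  simp only [ht]
  exact mul_ne_zero (Complex.ofReal_ne_zero.mpr htne) (Circle.coe_ne_zero _)

end PolygonalBilliard

/-! ### The Andreev segment and the folding onto `Ω⁺` -/

namespace PolygonalAndreevBilliard

variable (P : PolygonalAndreevBilliard)

/-- Away from the corners the closed sides are disjoint, so the connected segment lies in one of
them. -/
theorem exists_andreev_side : ∃ i, P.andreevSegment ⊆ P.openSide i := by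
  obtain ⟨z, hz, -⟩ := P.andreevSegment_nontrivial
  have hside : ∀ z ∈ P.andreevSegment, ∃ i, z ∈ P.openSide i := fun z hz =>
    (P.mem_frontier_iff.mp (P.andreevSegment_subset hz).1).resolve_left
      (P.andreevSegment_subset hz).2
  obtain ⟨i, hi⟩ := hside z hz
  have hcl : ∀ j, IsClosed (segment ℝ (P.vertex j) (P.vertex (j + 1))) := fun j => by
    rw [← closure_openSegment]; exact isClosed_closure
  refine ⟨i, ?_⟩
  have hmem : ∀ w ∈ P.andreevSegment, ∀ j, w ∈ segment ℝ (P.vertex j) (P.vertex (j + 1)) →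
      w ∈ P.openSide j := by
    intro w hw j hj
    obtain ⟨k, hk⟩ := hside w hw
    by_cases h : j = k
    · rwa [h]
    · exact absurd hj (P.notMem_side_of_mem_openSide h hk)
  have hsub := (isPreconnected_iff_subset_of_disjoint_closed.mp
    P.andreevSegment_connected.isPreconnected) (segment ℝ (P.vertex i) (P.vertex (i + 1)))
    (⋃ j : {j // j ≠ i}, segment ℝ (P.vertex j) (P.vertex (j + 1))) (hcl i)
    (isClosed_iUnion_of_finite fun j => hcl j) ?_ ?_
  · rcases hsub with h | h
    · exact fun w hw => hmem w hw i (h hw)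
    · obtain ⟨⟨j, hj⟩, hzj⟩ := mem_iUnion.mp (h hz)
      exact absurd hzj (P.notMem_side_of_mem_openSide hj hi)
  · intro w hw
    obtain ⟨j, hj⟩ := hside w hw
    by_cases h : j = i
    · subst h; exact .inl (P.openSide_subset_side _ hj)
    · exact .inr (mem_iUnion.mpr ⟨⟨j, h⟩, P.openSide_subset_side _ hj⟩)
  · rw [Set.eq_empty_iff_forall_notMem]
    rintro w ⟨hw, hwi, hwj⟩
    obtain ⟨⟨j, hj⟩, hwj⟩ := mem_iUnion.mp hwj
    exact P.notMem_side_of_mem_openSide hj (hmem w hw i hwi) hwj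

/-- The side that contains the Andreev segment. -/
noncomputable def andreevSide : ZMod P.n := P.exists_andreev_side.choose

theorem andreevSegment_subset_openSide : P.andreevSegment ⊆ P.openSide P.andreevSide :=
  P.exists_andreev_side.choose_spec

theorem andreevSide_re : (P.sideVec P.andreevSide).re = 0 := by
  obtain ⟨z, hz, w, hw, hzw⟩ := P.andreevSegment_nontrivial
  obtain ⟨s, -, rfl⟩ := P.mem_openSide_iff.mp (P.andreevSegment_subset_openSide hz)
  obtain ⟨t, -, rfl⟩ := P.mem_openSide_iff.mp (P.andreevSegment_subset_openSide hw)
  have h := P.andreevSegment_vertical _ hz _ hw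
  simp only [Complex.add_re, Complex.re_ofReal_mul] at h
  have h1 : (s - t) * (P.sideVec P.andreevSide).re = 0 := by linarith
  refine (mul_eq_zero.mp h1).resolve_left fun h2 => hzw ?_
  rw [sub_eq_zero.mp h2]

theorem lin_andreevSide (u : ℂ) : P.lin P.andreevSide u = -starRingEnd ℂ u := by
  have h1 : starRingEnd ℂ (P.sideVec P.andreevSide) = -P.sideVec P.andreevSide := by
    apply Complex.ext <;> simp [P.andreevSide_re]
  rw [PolygonalBilliard.lin, h1, div_neg, div_self (P.sideVec_ne_zero _), neg_one_mul]

/-- On a vertical side a point is determined by its imaginary part, and those of the segment form a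
nondegenerate interval; its midpoint between two given points serves. -/
theorem exists_interior_andreev_point : ∃ z ∈ P.openSide P.andreevSide,
    ∀ᶠ w in nhds z, w ∈ P.openSide P.andreevSide → w ∈ P.andreevSegment := by
  obtain ⟨a, ha, b, hb, hab⟩ := P.andreevSegment_nontrivial
  have hre : ∀ w ∈ P.openSide P.andreevSide, w.re = (P.vertex P.andreevSide).re := by
    intro w hw
    obtain ⟨t, -, rfl⟩ := P.mem_openSide_iff.mp hw
    simp [P.andreevSide_re]
  have him : ((fun w : ℂ => w.im) '' P.andreevSegment).OrdConnected :=
    (P.andreevSegment_connected.isPreconnected.image _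
      Complex.continuous_im.continuousOn).ordConnected
  have hmem : ∀ w ∈ P.openSide P.andreevSide, ∀ a ∈ P.andreevSegment, ∀ b ∈ P.andreevSegment,
      a.im < w.im → w.im < b.im → w ∈ P.andreevSegment := by
    intro w hw a ha b hb h1 h2
    obtain ⟨v, hv, hvw⟩ := him.out ⟨a, ha, rfl⟩ ⟨b, hb, rfl⟩ ⟨h1.le, h2.le⟩
    have : v = w := Complex.ext
      ((hre v (P.andreevSegment_subset_openSide hv)).trans (hre w hw).symm) hvw
    exact this ▸ hv
  have key : ∀ a ∈ P.andreevSegment, ∀ b ∈ P.andreevSegment, a.im < b.im →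
      ∃ z ∈ P.openSide P.andreevSide,
        ∀ᶠ w in nhds z, w ∈ P.openSide P.andreevSide → w ∈ P.andreevSegment := by
    intro a ha b hb hlt
    obtain ⟨v, hv, hvm⟩ := him.out ⟨a, ha, rfl⟩ ⟨b, hb, rfl⟩
      (⟨by simp only; linarith, by simp only; linarith⟩ : (a.im + b.im) / 2 ∈ Icc _ _)
    simp only at hvm
    refine ⟨v, P.andreevSegment_subset_openSide hv, ?_⟩
    filter_upwards [Complex.continuous_im.continuousAt.eventually (lt_mem_nhds
      (by linarith : a.im < v.im)), Complex.continuous_im.continuousAt.eventually (gt_mem_nhds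
      (by linarith : v.im < b.im))] with w h1 h2 hw
    exact hmem w hw a ha b hb h1 h2
  rcases lt_trichotomy a.im b.im with h | h | h
  · exact key a ha b hb h
  · exact absurd (Complex.ext (P.andreevSegment_vertical a ha b hb) h) hab
  · exact key b hb a ha h

variable {P}

theorem place_place (ε : Parity) (z : ℂ) : P.place ε (P.place ε z) = z := by
  cases ε
  · rfl
  · exact rho_rho z

theorem mem_place_image_iff {ε : Parity} {S : Set ℂ} {z : ℂ} :
    z ∈ P.place ε '' S ↔ P.place ε z ∈ S := by
  constructor
  · rintro ⟨w, hw, rfl⟩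
    rwa [place_place]
  · intro h
    exact ⟨_, h, place_place ε z⟩

theorem continuous_place (ε : Parity) : Continuous (P.place ε) := by
  cases ε
  · exact continuous_id
  · change Continuous P.rho
    have : P.rho = fun z => ((2 * P.axis - z.re : ℝ) : ℂ) + (z.im : ℂ) * Complex.I := by
      funext z
      apply Complex.ext <;> simp [rho]
    rw [this]
    fun_prop

theorem mem_insideOf_iff {ε : Parity} {z : ℂ} :
    z ∈ P.insideOf ε ↔ P.place ε z ∈ interior P.table := by
  let e : ℂ ≃ₜ ℂ :=
    { toFun := P.place ε
      invFun := P.place ε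
      left_inv := place_place ε
      right_inv := place_place ε
      continuous_toFun := continuous_place ε
      continuous_invFun := continuous_place ε }
  rw [insideOf, tableOf, ← mem_place_image_iff]
  change z ∈ interior (e '' P.table) ↔ z ∈ e '' interior P.table
  rw [e.image_interior]

/-- The direction `θ` in the table of parity `ε`, carried back to `Ω⁺`. -/
noncomputable def dirVec : Parity → Real.Angle → ℂ
  | .plus, θ => θ.toCircle
  | .minus, θ => -starRingEnd ℂ θ.toCircle

theorem dirVec_injective (ε : Parity) : Function.Injective (dirVec ε) := by
  intro θ φ h
  have h1 : (θ.toCircle : ℂ) = φ.toCircle := by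
    cases ε
    · exact h
    · exact (starRingEnd ℂ).injective (neg_injective h)
  rw [← Real.Angle.arg_toCircle θ, h1, Real.Angle.arg_toCircle]

theorem dirVec_add_pi (ε : Parity) (θ : Real.Angle) :
    dirVec ε (θ + (Real.pi : ℝ)) = -dirVec ε θ := by
  have : (((Real.pi : ℝ) : Real.Angle).toCircle : ℂ) = -1 := by
    simp
  cases ε <;> simp only [dirVec, Real.Angle.toCircle_add, Circle.coe_mul, this, map_mul, map_neg,
    map_one] <;> ring

theorem dirVec_andreevDir (ε : Parity) (θ : Real.Angle) :
    dirVec ε.flip (andreevDir θ) = -dirVec ε θ := by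
  rw [andreevDir_eq_neg]
  cases ε <;> simp only [dirVec, Parity.flip, Real.Angle.toCircle_neg, Circle.coe_inv_eq_conj,
    Complex.conj_conj, neg_neg]

theorem toCircle_reflectDir (d : ℂ) (hd : d ≠ 0) (θ : Real.Angle) :
    ((reflectDir ((d.arg : ℝ) : Real.Angle) θ).toCircle : ℂ) =
      d / starRingEnd ℂ d * starRingEnd ℂ (θ.toCircle : ℂ) := by
  have hn : (‖d‖ : ℂ) ≠ 0 := by simpa using hd
  have h1 : d / starRingEnd ℂ d = Complex.exp (d.arg * Complex.I) * Complex.exp (d.arg * Complex.I) := by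
    conv_lhs => rw [← Complex.norm_mul_exp_arg_mul_I d]
    rw [map_mul, Complex.conj_ofReal, ← Complex.exp_conj, map_mul, Complex.conj_I,
      Complex.conj_ofReal, mul_div_mul_left _ _ hn, ← Complex.exp_sub, ← Complex.exp_add]
    congr 1; ring
  rw [reflectDir, sub_eq_add_neg, two_nsmul, Real.Angle.toCircle_add, Real.Angle.toCircle_add,
    Real.Angle.toCircle_neg, Circle.coe_mul, Circle.coe_mul, Circle.coe_inv_eq_conj,
    Real.Angle.toCircle_coe, Circle.coe_exp, h1]

theorem dirVec_reflectDir (ε : Parity) (i : ZMod P.n) (θ : Real.Angle) :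
    dirVec ε (reflectDir (P.sideAngle ε i) θ) = P.lin i (dirVec ε θ) := by
  have hd := P.sideVec_ne_zero i
  have hd' := P.conj_sideVec_ne_zero i
  cases ε
  · exact toCircle_reflectDir _ hd θ
  · have h1 : P.vertexOf .minus (i + 1) - P.vertexOf .minus i = -starRingEnd ℂ (P.sideVec i) := by
      simp only [vertexOf, place, PolygonalBilliard.sideVec, rho]
      apply Complex.ext <;> simp
      ring
    rw [sideAngle, h1]
    simp only [dirVec]
    rw [toCircle_reflectDir _ (neg_ne_zero.mpr hd'), PolygonalBilliard.lin]
    simp only [map_neg, map_mul, map_div₀, Complex.conj_conj]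
    field_simp

theorem dirVec_flip (ε : Parity) (θ : Real.Angle) :
    dirVec ε.flip θ = P.lin P.andreevSide (dirVec ε θ) := by
  rw [P.lin_andreevSide]
  cases ε <;> simp [dirVec, Parity.flip]

theorem place_add (ε : Parity) (z : ℂ) (s : ℝ) (θ : Real.Angle) :
    P.place ε (z + s * (θ.toCircle : ℂ)) = P.place ε z + s * dirVec ε θ := by
  cases ε
  · rfl
  · simp only [place, rho, dirVec]
    apply Complex.ext <;> simp
    ring

namespace State

/-- The position of a state, carried back to `Ω⁺`. -/
def base (p : P.State) : ℂ := P.place p.parity p.pos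

/-- The direction of a state, carried back to `Ω⁺`. -/
noncomputable def vec (p : P.State) : ℂ := dirVec p.parity p.dir

theorem base_mem (p : P.State) : p.base ∈ P.table := mem_place_image_iff.mp p.pos_mem

theorem ext_base {p q : P.State} (h1 : p.parity = q.parity) (h2 : p.base = q.base)
    (h3 : p.vec = q.vec) : p = q := by
  unfold base at h2
  unfold vec at h3
  rw [h1] at h2 h3
  exact State.ext h1 (place_injective _ h2) (dirVec_injective _ h3)

end State

/-- In folded coordinates the two tables look alike: a mirror reflection acts by `lin`, and the
Andreev identification keeps the position, negates the direction and flips the parity. -/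
theorem rel_iff {p q : P.State} : Rel p q ↔ p = q ∨
    (q.parity = p.parity ∧ q.base = p.base ∧ p.base ∉ P.andreevSegment ∧
      ∃ i, p.base ∈ P.openSide i ∧ q.vec = P.lin i p.vec) ∨
    (q.parity = p.parity.flip ∧ q.base = p.base ∧ p.base ∈ P.andreevSegment ∧ q.vec = -p.vec) := by
  have hrho : ∀ ε (z : ℂ), P.place (Parity.flip ε) (P.rho z) = P.place ε z := by
    intro ε z
    cases ε
    · exact rho_rho z
    · rfl
  constructor
  · intro h
    cases h with
    | refl => exact .inl rfl
    | side _ i hparity hpos hside hA hdir =>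
      refine .inr (.inl ⟨hparity, ?_, fun h => hA (mem_place_image_iff.mpr h), i,
        mem_place_image_iff.mp hside, ?_⟩)
      · rw [State.base, State.base, hparity, hpos]
      · rw [State.vec, State.vec, hparity, hdir, dirVec_reflectDir]
    | andreev _ hparity hpos hA hdir =>
      refine .inr (.inr ⟨hparity, ?_, mem_place_image_iff.mp hA, ?_⟩)
      · rw [State.base, State.base, hparity, hpos, hrho]
      · rw [State.vec, State.vec, hparity, hdir, dirVec_andreevDir]
  · rintro (rfl | ⟨h1, h2, hA, i, hi, h3⟩ | ⟨h1, h2, hA, h3⟩)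
    · exact Rel.refl _
    · refine Rel.side _ _ i h1 ?_ (mem_place_image_iff.mpr hi)
        (fun h => hA (mem_place_image_iff.mp h)) ?_
      · rw [State.base, State.base, h1] at h2
        exact place_injective _ h2
      · rw [State.vec, State.vec, h1, ← dirVec_reflectDir] at h3
        exact dirVec_injective _ h3
    · refine Rel.andreev _ _ h1 ?_ (mem_place_image_iff.mpr hA) ?_
      · rw [State.base, State.base, h1, ← hrho p.parity p.pos] at h2
        exact place_injective _ h2
      · rw [State.vec, State.vec, h1, ← dirVec_andreevDir] at h3
        exact dirVec_injective _ h3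

theorem Rel.base_eq {p q : P.State} (h : Rel p q) : q.base = p.base := by
  rcases rel_iff.mp h with rfl | h | h
  · rfl
  · exact h.2.1
  · exact h.2.1

theorem freeMotion_iff {p w : P.State} {s : ℝ} : FreeMotion p s w ↔
    w.parity = p.parity ∧ w.vec = p.vec ∧ w.base = p.base + s * p.vec ∧
      w.base ∈ interior P.table := by
  constructor
  · rintro ⟨h1, h2, h3, h4⟩
    refine ⟨h1, by rw [State.vec, State.vec, h1, h2], ?_, mem_insideOf_iff.mp h4⟩
    rw [State.base, h3, h1, place_add]; rfl
  · rintro ⟨h1, h2, h3, h4⟩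
    refine ⟨h1, ?_, ?_, mem_insideOf_iff.mpr h4⟩
    · rw [State.vec, State.vec, h1] at h2
      exact dirVec_injective _ h2
    · rw [State.base, State.base, State.vec, h1, ← place_add] at h3
      exact place_injective _ h3

theorem toPhase_eq_iff {p q : P.State} : toPhase p = toPhase q ↔ Rel p q :=
  Quotient.eq (r := P.stateSetoid)

theorem exists_toPhase (x : P.PhaseSpace) : ∃ p : P.State, toPhase p = x :=
  Quotient.exists_rep x

theorem atCorner_toPhase {p : P.State} : AtCorner (toPhase p) ↔ p.base ∈ range P.vertex := by
  have h : ∀ q : P.State, q.pos ∈ range (P.vertexOf q.parity) ↔ q.base ∈ range P.vertex := by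
    intro q
    rw [show range (P.vertexOf q.parity) = P.place q.parity '' range P.vertex from
      range_comp _ _, mem_place_image_iff, State.base]
  constructor
  · rintro ⟨q, hq, hc⟩
    rw [(toPhase_eq_iff.mp hq).base_eq]
    exact (h q).mp hc
  · exact fun hp => ⟨p, rfl, (h p).mpr hp⟩

theorem Rel.eq_of_mem_interior {p q : P.State} (h : Rel p q) (hp : p.base ∈ interior P.table) :
    p = q := by
  rcases rel_iff.mp h with h | ⟨-, -, -, i, hi, -⟩ | ⟨-, -, hA, -⟩
  · exact h
  · exact absurd hp (P.notMem_interior_of_mem_frontier (P.openSide_subset_frontier i hi))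
  · exact absurd hp (P.notMem_interior_of_mem_frontier (P.andreevSegment_subset hA).1)

/-- The state moves into the interior of its table. -/
def Inward (p : P.State) : Prop :=
  ∃ δ > 0, ∀ s ∈ Ioo (0 : ℝ) δ, p.base + s * p.vec ∈ interior P.table

theorem Inward.inward_pos {p : P.State} (h : Inward p) {i : ZMod P.n}
    (hi : p.base ∈ P.openSide i) : 0 < P.inward i p.vec := by
  obtain ⟨δ, hδ, h⟩ := h
  obtain ⟨δ', hδ', h'⟩ := PolygonalBilliard.eventually_move_mem_interior_iff hi p.vec
  obtain ⟨s, hs⟩ := exists_between (lt_min hδ hδ')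
  exact (h' s ⟨hs.1, (lt_min_iff.mp hs.2).2⟩).mp (h s ⟨hs.1, (lt_min_iff.mp hs.2).1⟩)

theorem inward_of_pos {p : P.State} {i : ZMod P.n}
    (hi : p.base ∈ P.openSide i) (h : 0 < P.inward i p.vec) : Inward p := by
  obtain ⟨δ', hδ', h'⟩ := PolygonalBilliard.eventually_move_mem_interior_iff hi p.vec
  exact ⟨δ', hδ', fun s hs => (h' s hs).mpr h⟩

/-- Both nontrivial identifications negate the inward component at the side, so a class has at most
one inward representative. This is what makes the flow deterministic. -/
theorem Rel.eq_of_inward {p q : P.State} (h : Rel p q) (hp : Inward p) (hq : Inward q) :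
    p = q := by
  rcases rel_iff.mp h with h | ⟨-, hb, -, i, hi, hv⟩ | ⟨-, hb, hA, hv⟩
  · exact h
  · have h1 := hp.inward_pos hi
    have h2 := hq.inward_pos (hb ▸ hi)
    rw [hv, P.inward_lin] at h2
    linarith
  · have hi := P.andreevSegment_subset_openSide hA
    have h1 := hp.inward_pos hi
    have h2 := hq.inward_pos (hb ▸ hi)
    rw [hv, P.inward_neg] at h2
    linarith

end PolygonalAndreevBilliard

/-! ### Uniqueness of flow lines and time-reversing symmetries -/

namespace PolygonalAndreevBilliard

variable {P : PolygonalAndreevBilliard}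

/-- At the time `t` the curve leaves along the direction of a representative. -/
def DepartsAt (c : ℝ → P.PhaseSpace) (t : ℝ) : Prop :=
  ∃ p : P.State, toPhase p = c t ∧ ∃ δ > 0, ∀ s ∈ Ioo (0 : ℝ) δ,
    ∃ w, toPhase w = c (t + s) ∧ FreeMotion p s w

/-- At the time `t` the curve arrives along the direction of a representative. -/
def ArrivesAt (c : ℝ → P.PhaseSpace) (t : ℝ) : Prop :=
  ∃ q : P.State, toPhase q = c t ∧ ∃ δ > 0, ∀ s ∈ Ioo (-δ) (0 : ℝ),
    ∃ w, toPhase w = c (t + s) ∧ FreeMotion q s w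

theorem IsFlowLine.departsAt {c : ℝ → P.PhaseSpace} (h : IsFlowLine c) (t : ℝ) :
    DepartsAt c t := by
  obtain ⟨-, p, q, hp, -, δ, hδ, h, -⟩ := h t
  exact ⟨p, hp, δ, hδ, h⟩

theorem IsFlowLine.arrivesAt {c : ℝ → P.PhaseSpace} (h : IsFlowLine c) (t : ℝ) :
    ArrivesAt c t := by
  obtain ⟨-, p, q, -, hq, δ, hδ, -, h⟩ := h t
  exact ⟨q, hq, δ, hδ, h⟩

theorem DepartsAt.shift {c : ℝ → P.PhaseSpace} {t a : ℝ} (h : DepartsAt c (a + t)) :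
    DepartsAt (fun s => c (a + s)) t := by
  simpa only [DepartsAt, add_assoc] using h

theorem ArrivesAt.shift {c : ℝ → P.PhaseSpace} {t a : ℝ} (h : ArrivesAt c (a + t)) :
    ArrivesAt (fun s => c (a + s)) t := by
  simpa only [ArrivesAt, add_assoc] using h

theorem FreeMotion.unique {p w w' : P.State} {s : ℝ} (h : FreeMotion p s w)
    (h' : FreeMotion p s w') : w = w' := by
  rw [freeMotion_iff] at h h'
  exact State.ext_base (h.1.trans h'.1.symm) (h.2.2.1.trans h'.2.2.1.symm)
    (h.2.1.trans h'.2.1.symm)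

theorem FreeMotion.unique_source {p q w : P.State} {s : ℝ} (h : FreeMotion p s w)
    (h' : FreeMotion q s w) : p = q := by
  rw [freeMotion_iff] at h h'
  have hv : p.vec = q.vec := h.2.1.symm.trans h'.2.1
  refine State.ext_base (h.1.symm.trans h'.1) ?_ hv
  have := h.2.2.1.symm.trans h'.2.2.1
  rwa [hv, add_left_inj] at this

theorem inward_of_freeMotion {p : P.State} {δ : ℝ} (hδ : 0 < δ) {f : ℝ → P.PhaseSpace}
    (h : ∀ s ∈ Ioo (0 : ℝ) δ, ∃ w, toPhase w = f s ∧ FreeMotion p s w) : Inward p := by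
  refine ⟨δ, hδ, fun s hs => ?_⟩
  obtain ⟨w, -, hw⟩ := h s hs
  rw [freeMotion_iff] at hw
  exact hw.2.2.1 ▸ hw.2.2.2

/-- Agreement continues to the right because the departing representative is unique, and passes to
limits because an interior state just before determines the arriving representative. Only one-sided
conditions are required at the ends, so that a single flight between boundary points can be compared
with an orbit. -/
theorem eq_of_departsAt_of_arrivesAt {c c' : ℝ → P.PhaseSpace} {τ : ℝ} (h0 : c 0 = c' 0)
    (hd : ∀ s, 0 ≤ s → s < τ → DepartsAt c s) (hd' : ∀ s, 0 ≤ s → s < τ → DepartsAt c' s)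
    (ha : ∀ s, 0 < s → s ≤ τ → ArrivesAt c s) (ha' : ∀ s, 0 < s → s ≤ τ → ArrivesAt c' s) :
    ∀ s, 0 ≤ s → s ≤ τ → c s = c' s := by
  refine real_induction h0 ?_ ?_
  · intro s hs0 hsτ hs
    obtain ⟨p, hp, δ, hδ, h⟩ := hd s hs0 hsτ
    obtain ⟨p', hp', δ', hδ', h'⟩ := hd' s hs0 hsτ
    have hpp : p = p' := (toPhase_eq_iff.mp ((hp.trans (hs s hs0 le_rfl)).trans hp'.symm)).eq_of_inward
      (inward_of_freeMotion hδ h) (inward_of_freeMotion hδ' h')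
    subst hpp
    refine ⟨min δ δ', lt_min hδ hδ', fun r hr hr' => ?_⟩
    have h1 := min_le_left δ δ'
    have h2 := min_le_right δ δ'
    obtain ⟨w, hw, hwm⟩ := h (r - s) ⟨by linarith, by linarith⟩
    obtain ⟨w', hw', hwm'⟩ := h' (r - s) ⟨by linarith, by linarith⟩
    rw [add_sub_cancel] at hw hw'
    rw [← hw, ← hw', hwm.unique hwm']
  · intro s hs0 hsτ hs
    obtain ⟨q, hq, δ, hδ, h⟩ := ha s hs0 hsτ
    obtain ⟨q', hq', δ', hδ', h'⟩ := ha' s hs0 hsτ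
    obtain ⟨r, hr0, hr⟩ := exists_between (lt_min hs0 (lt_min hδ hδ'))
    rw [lt_min_iff, lt_min_iff] at hr
    obtain ⟨w, hw, hwm⟩ := h (-r) ⟨by linarith, by linarith⟩
    obtain ⟨w', hw', hwm'⟩ := h' (-r) ⟨by linarith, by linarith⟩
    have h1 : toPhase w = toPhase w' := by
      rw [hw, hw']; exact hs _ (by linarith) (by linarith)
    have h2 : w = w' := (toPhase_eq_iff.mp h1).eq_of_mem_interior (freeMotion_iff.mp hwm).2.2.2
    subst h2
    rw [← hq, ← hq', hwm.unique_source hwm']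

theorem IsFlowLine.eq_of_le {c c' : ℝ → P.PhaseSpace} (h : IsFlowLine c) (h' : IsFlowLine c')
    {a : ℝ} (ha : c a = c' a) {t : ℝ} (ht : a ≤ t) : c t = c' t := by
  have := eq_of_departsAt_of_arrivesAt (c := fun s => c (a + s)) (c' := fun s => c' (a + s))
    (τ := t - a) (by simpa using ha) (fun s _ _ => (h.departsAt _).shift)
    (fun s _ _ => (h'.departsAt _).shift) (fun s _ _ => (h.arrivesAt _).shift)
    (fun s _ _ => (h'.arrivesAt _).shift) (t - a) (by linarith) le_rfl
  simpa using this

/-- A transformation of the states that fixes the position, carried back to `Ω⁺`, and turns the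
direction by a half turn. -/
structure Reversal (P : PolygonalAndreevBilliard) where
  map : P.State → P.State
  onParity : Parity → Parity
  onParity_flip : ∀ ε, onParity ε.flip = (onParity ε).flip
  parity_map : ∀ p, (map p).parity = onParity p.parity
  base_map : ∀ p, (map p).base = p.base
  vec_map : ∀ p, (map p).vec = -p.vec

namespace Reversal

variable (F : Reversal P)

theorem rel_map {p q : P.State} (h : Rel p q) : Rel (F.map p) (F.map q) := by
  rcases rel_iff.mp h with rfl | ⟨h1, h2, hA, i, hi, h3⟩ | ⟨h1, h2, hA, h3⟩
  · exact Rel.refl _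
  · refine rel_iff.mpr (.inr (.inl ⟨?_, ?_, ?_, i, ?_, ?_⟩))
    · rw [F.parity_map, F.parity_map, h1]
    · rw [F.base_map, F.base_map, h2]
    · rwa [F.base_map]
    · rwa [F.base_map]
    · rw [F.vec_map, F.vec_map, h3, P.lin_neg]
  · refine rel_iff.mpr (.inr (.inr ⟨?_, ?_, ?_, ?_⟩))
    · rw [F.parity_map, F.parity_map, h1, F.onParity_flip]
    · rw [F.base_map, F.base_map, h2]
    · rwa [F.base_map]
    · rw [F.vec_map, F.vec_map, h3]

/-- The transformation of the phase space. -/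
def onPhase : P.PhaseSpace → P.PhaseSpace :=
  Quotient.map (sa := P.stateSetoid) (sb := P.stateSetoid) F.map fun _ _ h => F.rel_map h

theorem onPhase_toPhase (p : P.State) : F.onPhase (toPhase p) = toPhase (F.map p) := rfl

theorem freeMotion_map {p w : P.State} {s : ℝ} (h : FreeMotion p s w) :
    FreeMotion (F.map p) (-s) (F.map w) := by
  rw [freeMotion_iff] at h ⊢
  rw [F.parity_map, F.parity_map, F.vec_map, F.vec_map, F.base_map, F.base_map]
  exact ⟨by rw [h.1], by rw [h.2.1], by rw [h.2.2.1]; push_cast; ring, h.2.2.2⟩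

theorem isFlowLine {c : ℝ → P.PhaseSpace} (h : IsFlowLine c) (a : ℝ) :
    IsFlowLine fun t => F.onPhase (c (a - t)) := by
  intro t
  obtain ⟨hc, p, q, hp, hq, δ, hδ, h1, h2⟩ := h (a - t)
  refine ⟨?_, F.map q, F.map p, ?_, ?_, δ, hδ, fun s hs => ?_, fun s hs => ?_⟩
  · rw [← hp, atCorner_toPhase] at hc
    simp only [← hp, onPhase_toPhase, atCorner_toPhase, F.base_map]
    exact hc
  · rw [← onPhase_toPhase, hq]
  · rw [← onPhase_toPhase, hp]
  · obtain ⟨w, hw, hwm⟩ := h2 (-s) ⟨by linarith [hs.2], by linarith [hs.1]⟩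
    refine ⟨F.map w, ?_, by simpa using F.freeMotion_map hwm⟩
    rw [← onPhase_toPhase, hw]
    congr 2; ring
  · obtain ⟨w, hw, hwm⟩ := h1 (-s) ⟨by linarith [hs.2], by linarith [hs.1]⟩
    refine ⟨F.map w, ?_, by simpa using F.freeMotion_map hwm⟩
    rw [← onPhase_toPhase, hw]
    congr 2; ring

end Reversal

/-- Time reversal `(x, θ) ↦ (x, θ + π)`. -/
noncomputable def timeReversal : Reversal P where
  map p := { p with dir := p.dir + (Real.pi : ℝ) }
  onParity := id
  onParity_flip _ := rfl
  parity_map _ := rfl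
  base_map _ := rfl
  vec_map _ := dirVec_add_pi _ _

/-- The Andreev retroreflection `(x, θ) ↦ (ρ(x), r(θ) + π)`, which exchanges the tables. -/
noncomputable def retroreflection : Reversal P where
  map p := ⟨p.parity.flip, P.place p.parity.flip p.base, andreevDir p.dir, ⟨_, p.base_mem, rfl⟩⟩
  onParity := Parity.flip
  onParity_flip _ := rfl
  parity_map _ := rfl
  base_map _ := place_place _ _
  vec_map _ := dirVec_andreevDir _ _

theorem timeReversal_involutive (x : P.PhaseSpace) :
    timeReversal.onPhase (timeReversal.onPhase x) = x := by
  obtain ⟨p, rfl⟩ := exists_toPhase x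
  rw [Reversal.onPhase_toPhase, Reversal.onPhase_toPhase]
  congr 1
  refine State.ext_base rfl rfl ?_
  rw [Reversal.vec_map, Reversal.vec_map, neg_neg]

/-- Uniqueness in the past is uniqueness in the future for the time-reversed lines. -/
theorem IsFlowLine.eq {c c' : ℝ → P.PhaseSpace} (h : IsFlowLine c) (h' : IsFlowLine c')
    {a : ℝ} (ha : c a = c' a) (t : ℝ) : c t = c' t := by
  rcases le_total a t with hat | hat
  · exact h.eq_of_le h' ha hat
  · have := (timeReversal.isFlowLine h 0).eq_of_le (timeReversal.isFlowLine h' 0) (a := -a)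
      (by simp [ha]) (neg_le_neg hat)
    have := congrArg timeReversal.onPhase this
    simpa [timeReversal_involutive] using this

/-- The base point of the class `x` lies in the Andreev subset. -/
def AtAndreev (x : P.PhaseSpace) : Prop :=
  ∃ p : P.State, toPhase p = x ∧ p.base ∈ P.andreevSegment

theorem atAndreev_toPhase {p : P.State} : AtAndreev (toPhase p) ↔ p.base ∈ P.andreevSegment := by
  constructor
  · rintro ⟨q, hq, h⟩
    rwa [(toPhase_eq_iff.mp hq).base_eq]
  · exact fun h => ⟨p, rfl, h⟩

theorem AtAndreev.retroreflection_eq {x : P.PhaseSpace} (h : AtAndreev x) :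
    retroreflection.onPhase x = x := by
  obtain ⟨p, rfl, hp⟩ := h
  rw [Reversal.onPhase_toPhase, toPhase_eq_iff]
  exact Rel.symm (rel_iff.mpr (.inr (.inr ⟨rfl, Reversal.base_map _ _, hp, Reversal.vec_map _ _⟩)))

/-- Both sides are flow lines, and at time `a` they agree because the class there is fixed by the
retroreflection. -/
theorem IsFlowLine.eq_retroreflection {c : ℝ → P.PhaseSpace} (h : IsFlowLine c) {a : ℝ}
    (ha : AtAndreev (c a)) (t : ℝ) : c t = retroreflection.onPhase (c (2 * a - t)) := by
  refine h.eq (retroreflection.isFlowLine h (2 * a)) (a := a) ?_ t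
  simp only [two_mul, add_sub_cancel_right]
  exact ha.retroreflection_eq.symm

/-- An orbit that meets the Andreev subset twice is periodic. -/
theorem IsFlowLine.periodic {c : ℝ → P.PhaseSpace} (h : IsFlowLine c) {a b : ℝ}
    (ha : AtAndreev (c a)) (hb : AtAndreev (c b)) : Function.Periodic c (2 * (b - a)) := by
  intro t
  -- Both sides become the retroreflection of `c (2 * a - t)`.
  rw [h.eq_retroreflection hb, h.eq_retroreflection ha t]
  congr 2; ring

/-! ### Orbits that avoid the Andreev subset are billiard orbits -/

/-- The state `p` moved along its direction for the time `s`. -/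
noncomputable def State.move (p : P.State) (s : ℝ) (h : p.base + s * p.vec ∈ P.table) : P.State :=
  ⟨p.parity, P.place p.parity (p.base + s * p.vec), p.dir, ⟨_, h, rfl⟩⟩

theorem State.base_move (p : P.State) (s : ℝ) (h : p.base + s * p.vec ∈ P.table) :
    (p.move s h).base = p.base + s * p.vec := place_place _ _

theorem State.vec_move (p : P.State) (s : ℝ) (h : p.base + s * p.vec ∈ P.table) :
    (p.move s h).vec = p.vec := rfl

theorem freeMotion_move (p : P.State) {s t : ℝ} (hs : p.base + s * p.vec ∈ P.table)
    (ht : p.base + t * p.vec ∈ P.table) (hti : p.base + t * p.vec ∈ interior P.table) :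
    FreeMotion (p.move s hs) (t - s) (p.move t ht) := by
  rw [freeMotion_iff, State.base_move, State.base_move, State.vec_move, State.vec_move]
  exact ⟨rfl, rfl, by push_cast; ring, hti⟩

theorem IsFlowLine.eq_toPhase_move {c : ℝ → P.PhaseSpace} (hc : IsFlowLine c) {a : ℝ} {p : P.State}
    (hp : toPhase p = c a) {τ : ℝ} (hτ : 0 < τ)
    (hi : ∀ s ∈ Ioo 0 τ, p.base + s * p.vec ∈ interior P.table)
    (he : p.base + τ * p.vec ∈ P.table) : c (a + τ) = toPhase (p.move τ he) := by
  classical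
  have hmem : ∀ s, 0 ≤ s → s ≤ τ → p.base + s * p.vec ∈ P.table := by
    intro s h0 hs
    rcases h0.eq_or_lt with rfl | h0
    · simpa using p.base_mem
    rcases hs.eq_or_lt with rfl | hs
    · exact he
    · exact interior_subset (hi s ⟨h0, hs⟩)
  -- The value outside the table is a dummy; on `[0, τ]` the first case always applies.
  set f : ℝ → P.PhaseSpace := fun s =>
    if h : p.base + s * p.vec ∈ P.table then toPhase (p.move s h) else toPhase p with hf
  have hfs : ∀ (s : ℝ) (h : p.base + s * p.vec ∈ P.table), f s = toPhase (p.move s h) :=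
    fun s h => dif_pos h
  have h0 : c a = f 0 := by
    rw [hfs 0 (hmem 0 le_rfl hτ.le), ← hp]
    congr 1
    exact State.ext_base rfl (by rw [State.base_move]; simp) rfl
  have := eq_of_departsAt_of_arrivesAt (c := fun s => c (a + s)) (c' := f) (τ := τ)
    (by simpa using h0) (fun s _ _ => (hc.departsAt _).shift) ?_
    (fun s _ _ => (hc.arrivesAt _).shift) ?_ τ hτ.le le_rfl
  · rw [← hfs]; exact this
  · intro s hs0 hs
    refine ⟨_, (hfs s (hmem s hs0 hs.le)).symm, τ - s, by linarith, fun r hr => ?_⟩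
    have h1 := hi (s + r) ⟨by linarith [hr.1], by linarith [hr.2]⟩
    refine ⟨_, (hfs (s + r) (interior_subset h1)).symm, ?_⟩
    have := freeMotion_move p (hmem s hs0 hs.le) (interior_subset h1) h1
    rwa [add_sub_cancel_left] at this
  · intro s hs0 hs
    refine ⟨_, (hfs s (hmem s hs0.le hs)).symm, s, hs0, fun r hr => ?_⟩
    have h1 := hi (s + r) ⟨by linarith [hr.1], by linarith [hr.2]⟩
    refine ⟨_, (hfs (s + r) (interior_subset h1)).symm, ?_⟩
    have := freeMotion_move p (hmem s hs0.le hs) (interior_subset h1) h1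
    rwa [add_sub_cancel_left] at this

open PolygonalBilliard DirectionSet

variable {D : P.toPolygonalBilliard.DirectionSet}

/-- The flight cannot end in a corner because the orbit is defined for all times, nor in the Andreev
subset by `hA`; so it ends in a mirror reflection. -/
theorem IsFlowLine.exists_next {c : ℝ → P.PhaseSpace} (hc : IsFlowLine c) {a : ℝ} {p : P.State}
    (hp : toPhase p = c a) (hin : Inward p) (hv : p.vec ∈ D.dirs)
    (hA : ∀ t > a, ¬ AtAndreev (c t)) :
    ∃ τ : ℝ, 0 < τ ∧ ∃ (p' : P.State) (y : D.Label × ℝ), toPhase p' = c (a + τ) ∧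
      y.2 ∈ Ioo 0 y.1.width ∧ p'.base = point y ∧ p'.vec = y.1.dir ∧
      point y = p.base + τ * p.vec ∧ y.1.dir = P.lin y.1.side p.vec ∧
      ∀ t ∈ Ioo 0 τ, p.base + t * p.vec ∈ interior P.table := by
  obtain ⟨δ, hδ, hδi⟩ := hin
  obtain ⟨τ, hτ, hi, ⟨k, hk⟩ | ⟨j, hj, hn⟩⟩ := exists_flight hδ hδi (D.generic _ hv).transverse
  · exfalso
    have he : p.base + τ * p.vec ∈ P.table := by
      rw [hk]; exact P.frontier_subset_table (P.vertex_mem_frontier k)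
    have h1 := hc.eq_toPhase_move hp hτ hi he
    apply (hc (a + τ)).1
    rw [h1, atCorner_toPhase, State.base_move, hk]
    exact ⟨k, rfl⟩
  · have he : p.base + τ * p.vec ∈ P.table :=
      P.frontier_subset_table (P.openSide_subset_frontier j hj)
    have h1 := hc.eq_toPhase_move hp hτ hi he
    have hA' := hA (a + τ) (by linarith)
    rw [h1, atAndreev_toPhase, State.base_move] at hA'
    let q := p.move τ he
    let q' : P.State := { q with dir := reflectDir (P.sideAngle q.parity j) q.dir }
    have hq' : q'.vec = P.lin j p.vec := dirVec_reflectDir _ _ _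
    have hrel : Rel q q' := rel_iff.mpr (.inr (.inl ⟨rfl, rfl, by rwa [State.base_move], j,
      by rwa [State.base_move], hq'⟩))
    let b : D.Label := ⟨(j, P.lin j p.vec), D.lin_mem _ hv j, by
      simp only [P.inward_lin]; linarith⟩
    obtain ⟨t, ht, hpt⟩ := exists_point b hj
    refine ⟨τ, hτ, q', (b, t), ?_, ht, ?_, hq', hpt, rfl, hi⟩
    · rw [h1]; exact (toPhase_eq_iff.mpr hrel).symm
    · rw [hpt]; exact State.base_move p τ he

/-- In generic directions every orbit meets the Andreev subset in the future. -/
theorem IsFlowLine.exists_atAndreev {c : ℝ → P.PhaseSpace} (hc : IsFlowLine c) {p : P.State}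
    (hp : toPhase p = c 0) (hv : p.vec ∈ D.dirs) (hD : ∀ w ∈ D.dirs, -w ∈ D.dirs) :
    ∃ t > 0, AtAndreev (c t) := by
  by_contra! hA
  let Good : ℝ × (D.Label × ℝ) → Prop := fun g => 0 < g.1 ∧ g.2.2 ∈ Ioo 0 g.2.1.width ∧
    ∃ q : P.State, toPhase q = c g.1 ∧ q.base = point g.2 ∧ q.vec = g.2.1.dir
  have hstart : ∃ g, Good g := by
    -- The departing representative may differ from `p` by a mirror or Andreev reflection; the
    -- direction set is stable under both.
    obtain ⟨q, hq, δ, hδ, h⟩ := hc.departsAt 0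
    have hqv : q.vec ∈ D.dirs := by
      rcases rel_iff.mp (toPhase_eq_iff.mp (hp.trans hq.symm)) with
        rfl | ⟨-, -, -, i, -, h⟩ | ⟨-, -, -, h⟩
      · exact hv
      · rw [h]; exact D.lin_mem _ hv i
      · rw [h]; exact hD _ hv
    obtain ⟨τ, hτ, p', y, hp', hy, hb, hv', -⟩ :=
      hc.exists_next hq (inward_of_freeMotion hδ h) hqv hA
    exact ⟨(0 + τ, y), by simpa using hτ, hy, p', hp', hb, hv'⟩
  have hstep : ∀ g : {g // Good g}, ∃ g' : {g // Good g}, Bounce g.1.2 g'.1.2 := by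
    rintro ⟨⟨t, x⟩, ht, hx, q, hq, hb, hv⟩
    simp only at ht hx hq hb hv
    have hin : Inward q := inward_of_pos (hb ▸ point_mem hx) (hv ▸ x.1.width_pos)
    obtain ⟨τ, hτ, p', y, hp', hy, hb', hv', hyp, hyd, hyi⟩ :=
      hc.exists_next hq hin (hv ▸ x.1.dir_mem) fun s hs => hA s (lt_trans ht hs)
    rw [hb, hv] at hyp
    rw [hv] at hyd
    rw [hb, hv] at hyi
    exact ⟨⟨(t + τ, y), add_pos ht hτ, hy, p', hp', hb', hv'⟩, hx, hy, hyd, τ, hτ, hyp, hyi⟩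
  choose next hnext using hstep
  obtain ⟨g₀, hg₀⟩ := hstart
  let s : ℕ → {g // Good g} := fun n => next^[n] ⟨g₀, hg₀⟩
  have hs : ∀ n, Bounce (s n).1.2 (s (n + 1)).1.2 := fun n => by
    simp only [s, Function.iterate_succ_apply']
    exact hnext _
  -- The folded collisions form an infinite billiard orbit, so one of them falls on the Andreev
  -- segment. The collision times need not tend to infinity for this.
  obtain ⟨z, hz, hzA⟩ := P.exists_interior_andreev_point
  obtain ⟨n, hn⟩ := exists_point_mem (x := fun n => (s n).1.2) hs hz hzA
  obtain ⟨ht, -, q, hq, hb, -⟩ := (s n).2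
  refine hA _ ht ?_
  rw [← hq, atAndreev_toPhase, hb]
  exact hn

/-- Changing the table reflects the folded direction in the Andreev side, which is one of the sides
of the polygon. -/
theorem dirVec_mem_directions_of_mem {u : ℂ} {ε ε' : Parity} {θ : Real.Angle}
    (h : dirVec ε θ ∈ P.directions u) : dirVec ε' θ ∈ P.directions u := by
  have hflip : dirVec ε.flip θ ∈ P.directions u := by
    rw [dirVec_flip (P := P)]
    exact P.lin_mem_directions h _
  cases ε <;> cases ε' <;> first | exact h | exact hflip

theorem IsDirectionFrom.dirVec_mem {θ φ : Real.Angle} (h : P.IsDirectionFrom θ φ) (ε : Parity) :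
    dirVec ε φ ∈ P.directions θ.toCircle := by
  induction h generalizing ε with
  | base => exact dirVec_mem_directions_of_mem (ε := .plus) ⟨[], .inl rfl⟩
  | side ε' i u _ ih =>
    refine dirVec_mem_directions_of_mem (ε := ε') ?_
    rw [dirVec_reflectDir]
    exact P.lin_mem_directions (ih ε') i
  | andreev u _ ih =>
    refine dirVec_mem_directions_of_mem (ε := Parity.plus.flip) ?_
    rw [dirVec_andreevDir]
    exact P.neg_mem_directions (ih .plus)

end PolygonalAndreevBilliard

/-- For every rational polygonal Andreev billiard and Lebesgue-almost every direction `θ`, the flow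
restricted to the invariant surface `M±_θ` is closed. -/
theorem mainTheorem2 (P : PolygonalAndreevBilliard) (hP : P.toPolygonalBilliard.IsRational) :
    ∀ᵐ θ : ℝ ∂volume,
      PolygonalAndreevBilliard.FlowIsClosedOn (P.invariantSurface (θ : Real.Angle)) := by
  obtain ⟨N, hN, hturn⟩ := P.exists_pow_turn_eq_one hP P.andreevSide_re
  filter_upwards [P.ae_generic] with θ hθ
  rintro c hc ⟨p, hp, hpc⟩
  set D := P.directionSet hN hturn hθ
  have hv : p.vec ∈ D.dirs := PolygonalAndreevBilliard.IsDirectionFrom.dirVec_mem hp _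
  have hD : ∀ w ∈ D.dirs, -w ∈ D.dirs := fun w => P.neg_mem_directions
  obtain ⟨b, hb, hbA⟩ := hc.exists_atAndreev hpc hv hD
  obtain ⟨a, ha, haA⟩ :=
    (PolygonalAndreevBilliard.timeReversal.isFlowLine hc 0).exists_atAndreev (D := D)
      (p := PolygonalAndreevBilliard.timeReversal.map p)
      (by rw [← PolygonalAndreevBilliard.Reversal.onPhase_toPhase, hpc, sub_zero])
      (by rw [PolygonalAndreevBilliard.Reversal.vec_map]; exact hD _ hv) hD
  -- The time `a` of the reversed orbit is the time `-a` of `c`, and time reversal does not move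
  -- base points.
  have haA' : PolygonalAndreevBilliard.AtAndreev (c (0 - a)) := by
    obtain ⟨q, hq⟩ := PolygonalAndreevBilliard.exists_toPhase (c (0 - a))
    rw [← hq, PolygonalAndreevBilliard.Reversal.onPhase_toPhase,
      PolygonalAndreevBilliard.atAndreev_toPhase, PolygonalAndreevBilliard.Reversal.base_map] at haA
    rwa [← hq, PolygonalAndreevBilliard.atAndreev_toPhase]
  exact ⟨2 * (b - (0 - a)), by linarith, hc.periodic haA' hbA⟩
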